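/- Let $G$ be a discrete group, let $B$ be a unital C$^*$-algebra, let $UZ(B)$ be the group of unitary elements of the center of $B$, and let $\mathrm{Pic}(B)$ be the Picard group of $B$, i.e. the group of isomorphism classes $[M]$ of Morita equivalence $B$-bimodules (isomorphisms being bimodule isomorphisms that preserve the left and the right inner product), with multiplication induced by the internal tensor product $\otimes_B$. For a Morita equivalence $B$-bimodule $M$ let $\psi_M \in \mathrm{Aut}(UZ(B))$ be the automorphism determined by $\psi_M(u)\,m = m\,u$ for all $u \in UZ(B)$, $m \in M$; the map $[M] \mapsto \psi_M$ is a homomorphism $\mathrm{Pic}(B) \to \mathrm{Aut}(UZ(B))$. Let $\psi : G \to \mathrm{Pic}(B)$ be a group homomorphism, and let $H^p(G,UZ(B))_\psi$ be the cohomology (defined by normalized cochains) of $G$ with coefficients in $UZ(B)$, on which $G$ acts through $\psi$ and this homomorphism. Call a family $(B_g,\Psi_{g,h})_{g,h\in G}$ a choice for $\psi$ if each $B_g$ is a representative of $\psi(g)$, with $B_e = B$, and each $\Psi_{g,h} : B_g \otimes_B B_h \to B_{gh}$ is an isomorphism of Morita equivalence $B$-bimodules such that $\Psi_{e,g}$ and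 $\Psi_{g,e}$ are the left and the right action of $B$ on $B_g$ for all $g$ (in particular $\Psi_{e,e}=\mathrm{id}_B$). Then: 1. Choices for $\psi$ exist, and for every choice $(B_g,\Psi_{g,h})$ there is a unique map $\omega : G^3 \to UZ(B)$ with $$\Psi_{gh,k}\circ(\Psi_{g,h}\otimes \mathrm{id}) = \omega(g,h,k)\cdot \Psi_{g,hk}\circ(\mathrm{id}\otimes\Psi_{h,k}) \qquad (g,h,k\in G).$$ 2. This map $\omega$ is a normalized $3$-cocycle, and its class $\chi(\psi) := [\omega] \in H^3(G,UZ(B))_\psi$ is the same for all choices. 3. Let $\mathrm{Ext}(G,B,\psi)$ be the set of equivalence classes of saturated Fell bundles over $G$ with unit fiber $B$ whose fiber over $g$ represents $\psi(g)$ for every $g \in G$. Then $\mathrm{Ext}(G,B,\psi)$ is nonempty if and only if $\chi(\psi)$ vanishes. -/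

import Mathlib

universe u v w w'

namespace FellExt

/-! ## Group cohomology through normalized cochains -/

section Cohomology

variable {G : Type v} [Group G] {A : Type u} [CommGroup A]

/-- Normalized `p`-cochains on `G` with values in the (multiplicatively written) abelian group `A`:
maps `G ^ p → A` that are trivial as soon as one argument is the identity. -/
def cochains (G : Type v) [Group G] (A : Type u) [CommGroup A] (p : ℕ) :
    Subgroup ((Fin p → G) → A) where
  carrier := {f | ∀ g : Fin p → G, (∃ i, g i = 1) → f g = 1}
  mul_mem' := fun ha hb g hg => by simp [ha g hg, hb g hg]
  one_mem' := fun _ _ => rfl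
  inv_mem' := fun ha g hg => by simp [ha g hg]

/-- The group differential, for the action `S` of `G` on `A`:
`(d f)(g₀, …, g_p) = S(g₀)(f(g₁, …, g_p)) * ∏_{j=1}^{p} f(…, g_{j-1} g_j, …)^((-1)^j)
  * f(g₀, …, g_{p-1})^((-1)^(p+1))`. The factor with index `j : Fin (p + 1)` below is the one for
`j + 1` in this formula, the last one being `f(g₀, …, g_{p-1})` (`Fin.contractNth` at the last
index drops the last entry). -/
def differential (S : G →* MulAut A) (p : ℕ) :
    ((Fin p → G) → A) →* ((Fin (p + 1) → G) → A) where
  toFun f g := S (g 0) (f fun i => g i.succ) *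
    ∏ j : Fin (p + 1), f (Fin.contractNth j (· * ·) g) ^ ((-1 : ℤ) ^ ((j : ℕ) + 1))
  map_one' := by ext g; simp
  map_mul' f f' := by
    ext g
    simp only [Pi.mul_apply, map_mul, mul_zpow, Finset.prod_mul_distrib]
    exact mul_mul_mul_comm _ _ _ _

/-- Normalized `p`-cocycles. -/
def cocycles (S : G →* MulAut A) (p : ℕ) : Subgroup ((Fin p → G) → A) :=
  cochains G A p ⊓ (differential S p).ker

/-- Normalized `p`-coboundaries: differentials of normalized `(p - 1)`-cochains. -/
def coboundaries (S : G →* MulAut A) : (p : ℕ) → Subgroup ((Fin p → G) → A)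
  | 0 => ⊥
  | p + 1 => (cochains G A p).map (differential S p)

/-- The cohomology group `H ^ p (G, A)_S`, cocycles modulo coboundaries, written
multiplicatively. -/
abbrev Cohomology (S : G →* MulAut A) (p : ℕ) : Type (max u v) :=
  cocycles S p ⧸ (coboundaries S p).subgroupOf (cocycles S p)

end Cohomology

/-- `UZ(B)`: the group of unitary elements of the centre of `B`. -/
def UZ (B : Type u) [CStarAlgebra B] : Subgroup (unitary B) where
  carrier := {z | ∀ b : B, (z : B) * b = b * z}
  mul_mem' := fun {x y} hx hy b => by
    replace hx : ∀ b : B, (x : B) * b = b * x := hx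
    replace hy : ∀ b : B, (y : B) * b = b * y := hy
    rw [Submonoid.coe_mul, mul_assoc, hy, ← mul_assoc, hx, mul_assoc]
  one_mem' := fun b => by simp
  inv_mem' := fun {x} hx b => by
    have h : star (x : B) * b = b * star (x : B) := by
      simpa using (congrArg star (hx (star b))).symm
    exact h

instance (B : Type u) [CStarAlgebra B] : CommGroup (UZ B) :=
  { (inferInstance : Group (UZ B)) with
    mul_comm := fun x _ => Subtype.ext (Subtype.ext (x.2 _)) }

/-! ## Morita equivalence bimodules -/

/-- A Morita equivalence `B`-bimodule (imprimitivity `B`-`B`-bimodule): a Banach space with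
commuting left and right `B`-actions `l`, `r` and left and right `B`-valued inner products
`linner`, `rinner` that make it a full left and a full right Hilbert `B`-module, such that `B` acts
by adjointable operators on either side and `ₗ⟨x, y⟩ z = x ⟨y, z⟩ᵣ`. The left inner product is
conjugate-linear in the second variable, the right one in the first. An element of the
C⋆-algebra `B` is positive if it is of the form `star b * b`. -/
structure MoritaBimodule (B : Type u) [CStarAlgebra B] where
  carrier : Type w
  [normedAddCommGroup : NormedAddCommGroup carrier]
  [normedSpace : NormedSpace ℂ carrier]
  [completeSpace : CompleteSpace carrier]
  /-- the left action of `B` -/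
  l : B → carrier → carrier
  /-- the right action of `B` -/
  r : carrier → B → carrier
  l_add : ∀ a x y, l a (x + y) = l a x + l a y
  add_l : ∀ a b x, l (a + b) x = l a x + l b x
  l_smul : ∀ a (z : ℂ) x, l a (z • x) = z • l a x
  smul_l : ∀ a (z : ℂ) x, l (z • a) x = z • l a x
  mul_l : ∀ a b x, l (a * b) x = l a (l b x)
  one_l : ∀ x, l 1 x = x
  add_r : ∀ x y b, r (x + y) b = r x b + r y b
  r_add : ∀ x a b, r x (a + b) = r x a + r x b
  smul_r : ∀ (z : ℂ) x b, r (z • x) b = z • r x b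
  r_smul : ∀ (z : ℂ) x b, r x (z • b) = z • r x b
  r_mul : ∀ x a b, r x (a * b) = r (r x a) b
  r_one : ∀ x, r x 1 = x
  l_r : ∀ a x b, r (l a x) b = l a (r x b)
  /-- the left inner product -/
  linner : carrier → carrier → B
  /-- the right inner product -/
  rinner : carrier → carrier → B
  linner_add_left : ∀ x y z, linner (x + y) z = linner x z + linner y z
  linner_l_left : ∀ a x y, linner (l a x) y = a * linner x y
  star_linner : ∀ x y, star (linner x y) = linner y x
  linner_self_nonneg : ∀ x, ∃ b, linner x x = star b * b
  norm_sq_eq_linner : ∀ x, ‖x‖ ^ 2 = ‖linner x x‖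
  linner_full : Dense (Submodule.span ℂ (Set.range fun p : carrier × carrier =>
    linner p.1 p.2) : Set B)
  rinner_add_right : ∀ x y z, rinner x (y + z) = rinner x y + rinner x z
  rinner_r_right : ∀ x y b, rinner x (r y b) = rinner x y * b
  star_rinner : ∀ x y, star (rinner x y) = rinner y x
  rinner_self_nonneg : ∀ x, ∃ b, rinner x x = star b * b
  norm_sq_eq_rinner : ∀ x, ‖x‖ ^ 2 = ‖rinner x x‖
  rinner_full : Dense (Submodule.span ℂ (Set.range fun p : carrier × carrier =>
    rinner p.1 p.2) : Set B)
  rinner_l_left : ∀ a x y, rinner (l a x) y = rinner x (l (star a) y)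
  linner_r_left : ∀ x b y, linner (r x b) y = linner x (r y (star b))
  linner_l_eq : ∀ x y z, l (linner x y) z = r x (rinner y z)

namespace MoritaBimodule

variable {B : Type u} [CStarAlgebra B]

instance : CoeSort (MoritaBimodule.{u, w} B) (Type w) := ⟨carrier⟩

instance (M : MoritaBimodule.{u, w} B) : NormedAddCommGroup M := M.normedAddCommGroup
instance (M : MoritaBimodule.{u, w} B) : NormedSpace ℂ M := M.normedSpace
instance (M : MoritaBimodule.{u, w} B) : CompleteSpace M := M.completeSpace

/-- An isomorphism of Morita equivalence bimodules: a bijective bimodule map that preserves both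
inner products. -/
structure Iso (M : MoritaBimodule.{u, w} B) (N : MoritaBimodule.{u, w'} B) where
  toEquiv : M ≃ N
  map_add : ∀ x y, toEquiv (x + y) = toEquiv x + toEquiv y
  map_l : ∀ b x, toEquiv (M.l b x) = N.l b (toEquiv x)
  map_r : ∀ x b, toEquiv (M.r x b) = N.r (toEquiv x) b
  linner_map : ∀ x y, N.linner (toEquiv x) (toEquiv y) = M.linner x y
  rinner_map : ∀ x y, N.rinner (toEquiv x) (toEquiv y) = M.rinner x y

instance (M : MoritaBimodule.{u, w} B) (N : MoritaBimodule.{u, w'} B) :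
    CoeFun (Iso M N) fun _ => M → N := ⟨fun f => f.toEquiv⟩

/-- The identity isomorphism. -/
def Iso.refl (M : MoritaBimodule.{u, w} B) : Iso M M where
  toEquiv := Equiv.refl M
  map_add _ _ := rfl
  map_l _ _ := rfl
  map_r _ _ := rfl
  linner_map _ _ := rfl
  rinner_map _ _ := rfl

/-- The inverse isomorphism. -/
def Iso.symm {M : MoritaBimodule.{u, w} B} {N : MoritaBimodule.{u, w'} B} (f : Iso M N) :
    Iso N M where
  toEquiv := f.toEquiv.symm
  map_add x y := f.toEquiv.injective (by simp [f.map_add])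
  map_l b x := f.toEquiv.injective (by simp [f.map_l])
  map_r x b := f.toEquiv.injective (by simp [f.map_r])
  linner_map x y := by rw [← f.linner_map]; simp
  rinner_map x y := by rw [← f.rinner_map]; simp

/-- The composition of isomorphisms. -/
def Iso.trans {M N P : MoritaBimodule.{u, w} B} (f : Iso M N) (g : Iso N P) : Iso M P where
  toEquiv := f.toEquiv.trans g.toEquiv
  map_add x y := by simp [f.map_add, g.map_add]
  map_l b x := by simp [f.map_l, g.map_l]
  map_r x b := by simp [f.map_r, g.map_r]
  linner_map x y := by simp [f.linner_map, g.linner_map]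
  rinner_map x y := by simp [f.rinner_map, g.rinner_map]

section Basic

variable (M : MoritaBimodule.{u, w} B)

lemma linner_add_right (x y z : M) : M.linner x (y + z) = M.linner x y + M.linner x z := by
  rw [← M.star_linner, M.linner_add_left, star_add, M.star_linner, M.star_linner]

lemma rinner_add_left (x y z : M) : M.rinner (x + y) z = M.rinner x z + M.rinner y z := by
  rw [← M.star_rinner, M.rinner_add_right, star_add, M.star_rinner, M.star_rinner]

lemma linner_l_right (x : M) (a : B) (y : M) :
    M.linner x (M.l a y) = M.linner x y * star a := by
  rw [← M.star_linner, M.linner_l_left, star_mul, M.star_linner]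

lemma rinner_r_left (x : M) (b : B) (y : M) :
    M.rinner (M.r x b) y = star b * M.rinner x y := by
  rw [← M.star_rinner, M.rinner_r_right, star_mul, M.star_rinner]

lemma rinner_l_right (x : M) (a : B) (y : M) :
    M.rinner x (M.l a y) = M.rinner (M.l (star a) x) y := by
  rw [M.rinner_l_left, star_star]

lemma linner_r_right (x : M) (b : B) (y : M) :
    M.linner x (M.r y b) = M.linner (M.r x (star b)) y := by
  rw [M.linner_r_left, star_star]

lemma l_smul_eq (z : ℂ) (x : M) : M.l (z • 1) x = z • x := by rw [M.smul_l, M.one_l]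

lemma r_smul_eq (z : ℂ) (x : M) : M.r x (z • 1) = z • x := by rw [M.r_smul, M.r_one]

lemma linner_smul_left (z : ℂ) (x y : M) : M.linner (z • x) y = z • M.linner x y := by
  rw [← M.l_smul_eq, M.linner_l_left, smul_mul_assoc, one_mul]

lemma rinner_smul_right (z : ℂ) (x y : M) : M.rinner x (z • y) = z • M.rinner x y := by
  rw [← M.r_smul_eq, M.rinner_r_right, mul_smul_comm, mul_one]

/-- The left action as an additive map in the vector. -/
def lHom (a : B) : M →+ M := AddMonoidHom.mk' (M.l a) (M.l_add a)
/-- The left action as an additive map in the scalar. -/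
def lHom' (x : M) : B →+ M := AddMonoidHom.mk' (M.l · x) fun a b => M.add_l a b x
/-- The right action as an additive map in the vector. -/
def rHom (b : B) : M →+ M := AddMonoidHom.mk' (M.r · b) fun x y => M.add_r x y b
/-- The right action as an additive map in the scalar. -/
def rHom' (x : M) : B →+ M := AddMonoidHom.mk' (M.r x) (M.r_add x)
/-- The left inner product as an additive map in the first variable. -/
def linnerHom (y : M) : M →+ B :=
  AddMonoidHom.mk' (M.linner · y) fun a b => M.linner_add_left a b y
/-- The left inner product as an additive map in the second variable. -/
def linnerHom' (x : M) : M →+ B := AddMonoidHom.mk' (M.linner x) (M.linner_add_right x)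
/-- The right inner product as an additive map in the first variable. -/
def rinnerHom (y : M) : M →+ B :=
  AddMonoidHom.mk' (M.rinner · y) fun a b => M.rinner_add_left a b y
/-- The right inner product as an additive map in the second variable. -/
def rinnerHom' (x : M) : M →+ B := AddMonoidHom.mk' (M.rinner x) (M.rinner_add_right x)

variable {ι : Type*} (s : Finset ι)

lemma l_sum (a : B) (f : ι → M) : M.l a (∑ i ∈ s, f i) = ∑ i ∈ s, M.l a (f i) :=
  map_sum (M.lHom a) f s
lemma sum_l (f : ι → B) (x : M) : M.l (∑ i ∈ s, f i) x = ∑ i ∈ s, M.l (f i) x :=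
  map_sum (M.lHom' x) f s
lemma sum_r (f : ι → M) (b : B) : M.r (∑ i ∈ s, f i) b = ∑ i ∈ s, M.r (f i) b :=
  map_sum (M.rHom b) f s
lemma r_sum (x : M) (f : ι → B) : M.r x (∑ i ∈ s, f i) = ∑ i ∈ s, M.r x (f i) :=
  map_sum (M.rHom' x) f s
lemma linner_sum_left (f : ι → M) (y : M) :
    M.linner (∑ i ∈ s, f i) y = ∑ i ∈ s, M.linner (f i) y := map_sum (M.linnerHom y) f s
lemma linner_sum_right (x : M) (f : ι → M) :
    M.linner x (∑ i ∈ s, f i) = ∑ i ∈ s, M.linner x (f i) := map_sum (M.linnerHom' x) f s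
lemma rinner_sum_left (f : ι → M) (y : M) :
    M.rinner (∑ i ∈ s, f i) y = ∑ i ∈ s, M.rinner (f i) y := map_sum (M.rinnerHom y) f s
lemma rinner_sum_right (x : M) (f : ι → M) :
    M.rinner x (∑ i ∈ s, f i) = ∑ i ∈ s, M.rinner x (f i) := map_sum (M.rinnerHom' x) f s

lemma l_zero (a : B) : M.l a 0 = 0 := (M.lHom a).map_zero
lemma l_neg (a : B) (x : M) : M.l a (-x) = -M.l a x := (M.lHom a).map_neg x
lemma l_sub (a : B) (x y : M) : M.l a (x - y) = M.l a x - M.l a y := (M.lHom a).map_sub x y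
lemma sub_l (a b : B) (x : M) : M.l (a - b) x = M.l a x - M.l b x := (M.lHom' x).map_sub a b
lemma linner_sub_left (x y z : M) : M.linner (x - y) z = M.linner x z - M.linner y z :=
  (M.linnerHom z).map_sub x y
lemma linner_sub_right (x y z : M) : M.linner x (y - z) = M.linner x y - M.linner x z :=
  (M.linnerHom' x).map_sub y z
lemma rinner_sub_left (x y z : M) : M.rinner (x - y) z = M.rinner x z - M.rinner y z :=
  (M.rinnerHom z).map_sub x y
lemma rinner_sub_right (x y z : M) : M.rinner x (y - z) = M.rinner x y - M.rinner x z :=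
  (M.rinnerHom' x).map_sub y z

lemma eq_zero_of_linner_self {x : M} (h : M.linner x x = 0) : x = 0 := by
  have := M.norm_sq_eq_linner x
  rw [h, norm_zero] at this
  exact norm_eq_zero.1 (pow_eq_zero_iff two_ne_zero |>.1 this)

lemma eq_zero_of_rinner_self {x : M} (h : M.rinner x x = 0) : x = 0 := by
  have := M.norm_sq_eq_rinner x
  rw [h, norm_zero] at this
  exact norm_eq_zero.1 (pow_eq_zero_iff two_ne_zero |>.1 this)

lemma ext_linner {x y : M} (h : ∀ z, M.linner x z = M.linner y z) : x = y := by
  refine sub_eq_zero.1 (M.eq_zero_of_linner_self ?_)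
  rw [M.linner_sub_left, h, sub_self]

lemma ext_rinner {x y : M} (h : ∀ z, M.rinner z x = M.rinner z y) : x = y := by
  refine sub_eq_zero.1 (M.eq_zero_of_rinner_self ?_)
  rw [M.rinner_sub_right, h, sub_self]

open scoped InnerProductSpace in
lemma norm_linner_le (x y : M) : ‖M.linner x y‖ ≤ ‖x‖ * ‖y‖ := by
  let _ := CStarAlgebra.spectralOrder B
  have _ := CStarAlgebra.spectralOrderedRing B
  let _ : SMul B M := ⟨M.l⟩
  let _ : CStarModule B M :=
    { inner := fun x y => M.linner y x
      inner_add_right := M.linner_add_left _ _ _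
      inner_self_nonneg := CStarAlgebra.nonneg_iff_eq_star_mul_self.2 (M.linner_self_nonneg _)
      inner_self := ⟨M.eq_zero_of_linner_self, fun h => by
        subst h; exact (M.linnerHom 0).map_zero⟩
      inner_op_smul_right := M.linner_l_left _ _ _
      inner_smul_right_complex := M.linner_smul_left _ _ _
      star_inner := fun x y => M.star_linner y x
      norm_eq_sqrt_norm_inner_self := fun x => by
        rw [← M.norm_sq_eq_linner, Real.sqrt_sq (norm_nonneg x)] }
  rw [mul_comm]
  exact CStarModule.norm_inner_le (A := B) (M : Type w) (x := y) (y := x)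

end Basic

/-- `B` itself as a Morita equivalence `B`-bimodule: `ₗ⟨a, b⟩ = a b⋆`, `⟨a, b⟩ᵣ = a⋆ b`. -/
noncomputable def self (B : Type u) [CStarAlgebra B] : MoritaBimodule.{u, u} B where
  carrier := B
  l a x := a * x
  r x b := x * b
  l_add := mul_add
  add_l := add_mul
  l_smul a z x := mul_smul_comm z a x
  smul_l a z x := smul_mul_assoc z a x
  mul_l := mul_assoc
  one_l := one_mul
  add_r := add_mul
  r_add := mul_add
  smul_r z x b := smul_mul_assoc z x b
  r_smul z x b := mul_smul_comm z x b
  r_mul x a b := (mul_assoc x a b).symm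
  r_one := mul_one
  l_r := mul_assoc
  linner x y := x * star y
  rinner x y := star x * y
  linner_add_left x y z := add_mul _ _ _
  linner_l_left a x y := mul_assoc _ _ _
  star_linner x y := by simp
  linner_self_nonneg x := ⟨star x, by simp⟩
  norm_sq_eq_linner x := by rw [CStarRing.norm_self_mul_star, sq]
  linner_full := by
    refine dense_univ.mono fun x _ => Submodule.subset_span ⟨(x, 1), by simp⟩
  rinner_add_right x y z := mul_add _ _ _
  rinner_r_right x y b := (mul_assoc _ _ _).symm
  star_rinner x y := by simp
  rinner_self_nonneg x := ⟨x, rfl⟩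
  norm_sq_eq_rinner x := by rw [CStarRing.norm_star_mul_self, sq]
  rinner_full := by
    refine dense_univ.mono fun x _ => Submodule.subset_span ⟨(1, x), by simp⟩
  rinner_l_left a x y := by simp [mul_assoc]
  linner_r_left x b y := by simp [mul_assoc]
  linner_l_eq x y z := mul_assoc _ _ _

/-- The dual (conjugate) bimodule: the same additive group with conjugated scalar multiplication,
`b · x̄ = (x · b⋆)‾`, `x̄ · b = (b⋆ · x)‾` and the two inner products interchanged. -/
def dual (M : MoritaBimodule.{u, w} B) : MoritaBimodule.{u, w} B where
  carrier := M
  normedSpace :=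
    { smul := fun z x => star z • x
      one_smul := fun x => by change star (1 : ℂ) • x = x; simp
      mul_smul := fun z z' x => by
        change star (z * z') • x = star z • star z' • x
        rw [star_mul', mul_smul]
      smul_zero := fun z => by change star z • (0 : M) = 0; simp
      smul_add := fun z x y => by change star z • (x + y) = star z • x + star z • y; simp
      add_smul := fun z z' x => by
        change star (z + z') • x = star z • x + star z' • x
        rw [star_add, add_smul]
      zero_smul := fun x => by change star (0 : ℂ) • x = 0; simp
      norm_smul_le := fun z x => by
        change ‖star z • x‖ ≤ _
        rw [norm_smul, norm_star] }
  l b x := M.r x (star b)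
  r x b := M.l (star b) x
  l_add a x y := M.add_r x y _
  add_l a b x := by rw [star_add, M.r_add]
  l_smul a z x := M.smul_r (star z) x _
  smul_l a z x := by rw [star_smul, M.r_smul]; rfl
  mul_l a b x := by rw [star_mul, M.r_mul]
  one_l x := by rw [star_one, M.r_one]
  add_r x y b := M.l_add _ x y
  r_add x a b := by rw [star_add, M.add_l]
  smul_r z x b := M.l_smul _ (star z) x
  r_smul z x b := by rw [star_smul, M.smul_l]; rfl
  r_mul x a b := by rw [star_mul, M.mul_l]
  r_one x := by rw [star_one, M.one_l]
  l_r a x b := (M.l_r _ x _).symm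
  linner x y := M.rinner x y
  rinner x y := M.linner x y
  linner_add_left := M.rinner_add_left
  linner_l_left a x y := by rw [M.rinner_r_left, star_star]
  star_linner := M.star_rinner
  linner_self_nonneg := M.rinner_self_nonneg
  norm_sq_eq_linner := M.norm_sq_eq_rinner
  linner_full := M.rinner_full
  rinner_add_right := M.linner_add_right
  rinner_r_right x y b := by rw [M.linner_l_right, star_star]
  star_rinner := M.star_linner
  rinner_self_nonneg := M.linner_self_nonneg
  norm_sq_eq_rinner := M.norm_sq_eq_linner
  rinner_full := M.linner_full
  rinner_l_left a x y := M.linner_r_left x _ y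
  linner_r_left x b y := M.rinner_l_left _ x y
  linner_l_eq x y z := by rw [M.star_rinner, M.star_linner, M.linner_l_eq]

/-- Isomorphic bimodules have isomorphic duals. -/
def Iso.dual {M N : MoritaBimodule.{u, w} B} (f : Iso M N) : Iso M.dual N.dual where
  toEquiv := f.toEquiv
  map_add := f.map_add
  map_l _ x := f.map_r x _
  map_r x _ := f.map_l _ x
  linner_map := f.rinner_map
  rinner_map := f.linner_map

/-- A bijection that preserves both inner products is an isomorphism. -/
def Iso.ofInner {M N : MoritaBimodule.{u, w} B} (f : M ≃ N)
    (hl : ∀ x y, N.linner (f x) (f y) = M.linner x y)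
    (hr : ∀ x y, N.rinner (f x) (f y) = M.rinner x y) : Iso M N where
  toEquiv := f
  map_add x y := N.ext_linner fun z => by
    obtain ⟨z, rfl⟩ := f.surjective z
    rw [N.linner_add_left, hl, hl, hl, M.linner_add_left]
  map_l b x := N.ext_linner fun z => by
    obtain ⟨z, rfl⟩ := f.surjective z
    rw [N.linner_l_left, hl, hl, M.linner_l_left]
  map_r x b := N.ext_rinner fun z => by
    obtain ⟨z, rfl⟩ := f.surjective z
    rw [N.rinner_r_right, hr, hr, M.rinner_r_right]
  linner_map := hl
  rinner_map := hr

lemma exists_conj_eq_one [PartialOrder B] [StarOrderedRing B] {c : B} (hc : 1 ≤ c) :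
    ∃ e : B, e * c * star e = 1 := by
  have hc0 : 0 ≤ c := zero_le_one.trans hc
  have hu : IsUnit c := CStarAlgebra.isUnit_of_le 1 hc
  have hs : CFC.sqrt c * CFC.sqrt c = c := CFC.sqrt_mul_sqrt_self c
  have hd : IsUnit (CFC.sqrt c) := by
    have h : IsUnit (CFC.sqrt c * CFC.sqrt c) := by rwa [hs]
    exact ((Commute.refl (CFC.sqrt c)).isUnit_mul_iff.1 h).1
  have hsa : star (CFC.sqrt c) = CFC.sqrt c := (CFC.sqrt_nonneg c).isSelfAdjoint
  obtain ⟨d, hd⟩ := hd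
  rw [← hd] at hs hsa
  refine ⟨↑d⁻¹, ?_⟩
  have h1 : (d : B) * star (↑d⁻¹ : B) = 1 := by
    calc (d : B) * star (↑d⁻¹ : B) = star (d : B) * star (↑d⁻¹ : B) := by rw [hsa]
      _ = 1 := by rw [← star_mul, Units.inv_mul, star_one]
  rw [← hs, Units.inv_mul_cancel_left, h1]

/-- By fullness there is a finite family with `∑ ₗ⟨x i, x i⟩ = 1`. -/
lemma exists_frame (M : MoritaBimodule.{u, w} B) :
    ∃ (ι : Type) (_ : Fintype ι) (x : ι → M), ∑ i, M.linner (x i) (x i) = 1 := by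
  let _ := CStarAlgebra.spectralOrder B
  have _ := CStarAlgebra.spectralOrderedRing B
  have key : ∀ s ∈ Submodule.span ℂ (Set.range fun p : M × M => M.linner p.1 p.2),
      ∃ (ι : Type) (_ : Fintype ι) (x y : ι → M), s = ∑ i, M.linner (x i) (y i) := by
    intro s hs
    induction hs using Submodule.span_induction with
    | mem s hs =>
      obtain ⟨p, rfl⟩ := hs
      exact ⟨Unit, inferInstance, fun _ => p.1, fun _ => p.2, by simp⟩
    | zero => exact ⟨Empty, inferInstance, Empty.elim, Empty.elim, by simp⟩
    | add s t _ _ hs ht =>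
      obtain ⟨ι, _, x, y, rfl⟩ := hs
      obtain ⟨κ, _, x', y', rfl⟩ := ht
      exact ⟨ι ⊕ κ, inferInstance, Sum.elim x x', Sum.elim y y', by simp⟩
    | smul z s _ hs =>
      obtain ⟨ι, _, x, y, rfl⟩ := hs
      exact ⟨ι, inferInstance, fun i => z • x i, y, by
        simp [M.linner_smul_left, Finset.smul_sum]⟩
  obtain ⟨s, hs, h1⟩ := Metric.mem_closure_iff.1 (M.linner_full 1) 1 one_pos
  have hu : IsUnit s := by
    rw [dist_eq_norm] at h1
    simpa using (Units.oneSub _ h1).isUnit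
  obtain ⟨a, rfl⟩ := hu
  obtain ⟨ι, _, x, y, hxy⟩ := key _ hs
  have h2 : ∑ i, M.linner (M.l (↑a⁻¹ : B) (x i)) (y i) = 1 := by
    simp_rw [M.linner_l_left]
    rw [← Finset.mul_sum, ← hxy, Units.inv_mul]
  set x' : ι → M := fun i => M.l (↑a⁻¹ : B) (x i) with hx'
  have hle : (1 : B) ≤ ∑ i, (M.linner (x' i) (x' i) + M.linner (y i) (y i)) := by
    have h3 : (0 : B) ≤ ∑ i, M.linner (x' i - y i) (x' i - y i) :=
      Finset.sum_nonneg fun i _ =>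
        CStarAlgebra.nonneg_iff_eq_star_mul_self.2 (M.linner_self_nonneg _)
    have h4 : ∑ i, M.linner (y i) (x' i) = 1 := by
      simp_rw [← M.star_linner (x' _) (y _)]
      rw [← star_sum, h2, star_one]
    have h5 : ∑ i, M.linner (x' i - y i) (x' i - y i) =
        ∑ i, (M.linner (x' i) (x' i) + M.linner (y i) (y i)) - 1 - 1 := by
      nth_rewrite 1 [← h2]
      rw [← h4, ← Finset.sum_sub_distrib, ← Finset.sum_sub_distrib]
      refine Finset.sum_congr rfl fun i _ => ?_
      rw [M.linner_sub_left, M.linner_sub_right, M.linner_sub_right]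
      abel
    rw [h5, sub_sub, sub_nonneg] at h3
    exact le_trans (le_add_of_nonneg_left zero_le_one) h3
  obtain ⟨e, he⟩ := exists_conj_eq_one hle
  refine ⟨ι ⊕ ι, inferInstance, Sum.elim (fun i => M.l e (x' i)) (fun i => M.l e (y i)), ?_⟩
  rw [Fintype.sum_sum_type]
  simp only [Sum.elim_inl, Sum.elim_inr, M.linner_l_left, M.linner_l_right]
  rw [← he, ← Finset.sum_add_distrib, Finset.mul_sum, Finset.sum_mul]
  exact Finset.sum_congr rfl fun i _ => by rw [mul_add, add_mul, mul_assoc, mul_assoc]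
lemma exists_frame' (M : MoritaBimodule.{u, w} B) :
    ∃ (ι : Type) (_ : Fintype ι) (x : ι → M), ∑ i, M.rinner (x i) (x i) = 1 :=
  M.dual.exists_frame

/-- The reconstruction formula of a frame. -/
lemma frame_sum {M : MoritaBimodule.{u, w} B} {ι : Type} [Fintype ι] {x : ι → M}
    (hx : ∑ i, M.linner (x i) (x i) = 1) (m : M) : ∑ i, M.r (x i) (M.rinner (x i) m) = m := by
  simp_rw [← M.linner_l_eq]
  rw [← M.sum_l, hx, M.one_l]

lemma nonempty_iso_of_closure {I : Type*} {P P' : MoritaBimodule.{u, w} B}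
    (β : I → P) (β' : I → P')
    (hβ : AddSubgroup.closure (Set.range β) = ⊤) (hβ' : AddSubgroup.closure (Set.range β') = ⊤)
    (hl : ∀ i j, P'.linner (β' i) (β' j) = P.linner (β i) (β j))
    (hr : ∀ i j, P'.rinner (β' i) (β' j) = P.rinner (β i) (β j)) : Nonempty (Iso P P') := by
  have surj : ∀ {Q : MoritaBimodule.{u, w} B} (γ : I → Q),
      AddSubgroup.closure (Set.range γ) = ⊤ →
      Function.Surjective (FreeAbelianGroup.lift γ) := by
    intro Q γ h
    rw [← AddMonoidHom.range_eq_top, ← top_le_iff, ← h, AddSubgroup.closure_le]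
    rintro _ ⟨i, rfl⟩
    exact ⟨FreeAbelianGroup.of i, by simp⟩
  set L := FreeAbelianGroup.lift β with hL
  set L' := FreeAbelianGroup.lift β' with hL'
  have hL1 : ∀ i, L (FreeAbelianGroup.of i) = β i := fun i => by simp [hL]
  have hL1' : ∀ i, L' (FreeAbelianGroup.of i) = β' i := fun i => by simp [hL']
  have hl' : ∀ v w, P'.linner (L' v) (L' w) = P.linner (L v) (L w) := by
    intro v w
    have h1 : ∀ w i, P'.linner (L' (.of i)) (L' w) = P.linner (L (.of i)) (L w) := fun w i => by
      have : (P'.linnerHom' (L' (.of i))).comp L' = (P.linnerHom' (L (.of i))).comp L :=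
        FreeAbelianGroup.lift_ext _ _ fun j => by
          change P'.linner _ _ = P.linner _ _
          rw [hL1, hL1, hL1', hL1', hl]
      exact DFunLike.congr_fun this w
    have : (P'.linnerHom (L' w)).comp L' = (P.linnerHom (L w)).comp L :=
      FreeAbelianGroup.lift_ext _ _ fun j => h1 w j
    exact DFunLike.congr_fun this v
  have hr' : ∀ v w, P'.rinner (L' v) (L' w) = P.rinner (L v) (L w) := by
    intro v w
    have h1 : ∀ w i, P'.rinner (L' (.of i)) (L' w) = P.rinner (L (.of i)) (L w) := fun w i => by
      have : (P'.rinnerHom' (L' (.of i))).comp L' = (P.rinnerHom' (L (.of i))).comp L :=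
        FreeAbelianGroup.lift_ext _ _ fun j => by
          change P'.rinner _ _ = P.rinner _ _
          rw [hL1, hL1, hL1', hL1', hr]
      exact DFunLike.congr_fun this w
    have : (P'.rinnerHom (L' w)).comp L' = (P.rinnerHom (L w)).comp L :=
      FreeAbelianGroup.lift_ext _ _ fun j => h1 w j
    exact DFunLike.congr_fun this v
  have heq : ∀ v w, L v = L w ↔ L' v = L' w := by
    intro v w
    rw [← sub_eq_zero, ← map_sub, ← sub_eq_zero (a := L' v), ← map_sub]
    constructor
    · intro h
      exact P'.eq_zero_of_linner_self (by rw [hl', h]; exact (P.linnerHom 0).map_zero)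
    · intro h
      exact P.eq_zero_of_linner_self (by rw [← hl', h]; exact (P'.linnerHom 0).map_zero)
  have hs := surj β hβ
  have hs' := surj β' hβ'
  have hsi := Function.surjInv_eq hs
  let f : P → P' := fun p => L' (Function.surjInv hs p)
  have hf : Function.Bijective f := by
    refine ⟨fun p q h => ?_, fun q => ?_⟩
    · have := (heq _ _).2 h
      rwa [hsi, hsi] at this
    · obtain ⟨v, rfl⟩ := hs' q
      exact ⟨L v, (heq _ _).1 (hsi _)⟩
  exact ⟨Iso.ofInner (Equiv.ofBijective f hf)
    (fun x y => by change P'.linner (L' _) (L' _) = _; rw [hl', hsi, hsi])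
    (fun x y => by change P'.rinner (L' _) (L' _) = _; rw [hr', hsi, hsi])⟩

/-! ### The internal tensor product -/

/-- `TensorMap M N P` consists of a balanced biadditive `B`-bimodule map `(m, n) ↦ m ⊗ n` from
`M × N` to `P` with `⟨m ⊗ n, m' ⊗ n'⟩ᵣ = ⟨n, ⟨m, m'⟩ᵣ n'⟩ᵣ`,
`ₗ⟨m ⊗ n, m' ⊗ n'⟩ = ₗ⟨m ₗ⟨n, n'⟩, m'⟩` and dense span of its range. It exhibits `P` as the
internal tensor product of `M` and `N` (the Hausdorff completion of the algebraic tensor product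
over `B` for these inner products). -/
structure TensorMap (M N P : MoritaBimodule.{u, w} B) where
  toFun : M → N → P
  add_left : ∀ m m' n, toFun (m + m') n = toFun m n + toFun m' n
  add_right : ∀ m n n', toFun m (n + n') = toFun m n + toFun m n'
  balanced : ∀ m b n, toFun (M.r m b) n = toFun m (N.l b n)
  map_l : ∀ b m n, toFun (M.l b m) n = P.l b (toFun m n)
  map_r : ∀ m n b, toFun m (N.r n b) = P.r (toFun m n) b
  linner_map : ∀ m n m' n',
    P.linner (toFun m n) (toFun m' n') = M.linner (M.r m (N.linner n n')) m'
  rinner_map : ∀ m n m' n',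
    P.rinner (toFun m n) (toFun m' n') = N.rinner n (N.l (M.rinner m m') n')
  dense : Dense (Submodule.span ℂ (Set.range fun p : M × N => toFun p.1 p.2) : Set P)

namespace TensorMap

variable {M N P : MoritaBimodule.{u, w} B} (β : TensorMap M N P)

/-- As `B` is unital, the range of a tensor map generates already algebraically. -/
lemma closure_eq_top :
    AddSubgroup.closure (Set.range fun p : M × N => β.toFun p.1 p.2) = ⊤ := by
  set S := AddSubgroup.closure (Set.range fun p : M × N => β.toFun p.1 p.2) with hS
  have hl : ∀ b, ∀ p ∈ S, P.l b p ∈ S := by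
    intro b p hp
    induction hp using AddSubgroup.closure_induction with
    | mem p hp =>
      obtain ⟨q, rfl⟩ := hp
      exact AddSubgroup.subset_closure ⟨(M.l b q.1, q.2), β.map_l b q.1 q.2⟩
    | zero => rw [P.l_zero]; exact S.zero_mem
    | add x y _ _ hx hy => rw [P.l_add]; exact S.add_mem hx hy
    | neg x _ hx => rw [P.l_neg]; exact S.neg_mem hx
  have hr : ∀ b, ∀ p ∈ S, P.r p b ∈ S := by
    intro b p hp
    induction hp using AddSubgroup.closure_induction with
    | mem p hp =>
      obtain ⟨q, rfl⟩ := hp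
      exact AddSubgroup.subset_closure ⟨(q.1, N.r q.2 b), β.map_r q.1 q.2 b⟩
    | zero => rw [show P.r 0 b = 0 from (P.rHom b).map_zero]; exact S.zero_mem
    | add x y _ _ hx hy => rw [P.add_r]; exact S.add_mem hx hy
    | neg x _ hx => rw [show P.r (-x) b = -P.r x b from (P.rHom b).map_neg x]; exact S.neg_mem hx
  have hd : ∀ p : P, ∀ ε > 0, ∃ s ∈ S, ‖p - s‖ < ε := by
    intro p ε hε
    obtain ⟨s, hs, h⟩ := Metric.mem_closure_iff.1 (β.dense p) ε hε
    refine ⟨s, ?_, by rwa [dist_eq_norm] at h⟩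
    clear h
    induction hs using Submodule.span_induction with
    | mem x hx => exact AddSubgroup.subset_closure hx
    | zero => exact S.zero_mem
    | add x y _ _ hx hy => exact S.add_mem hx hy
    | smul z x _ hx => rw [← P.l_smul_eq]; exact hl _ _ hx
  obtain ⟨ι, _, x, hx⟩ := P.exists_frame
  have hC : 0 < ∑ i, ‖x i‖ + 1 := by positivity
  choose s hs hsx using fun i => hd (x i) (∑ i, ‖x i‖ + 1)⁻¹ (inv_pos.2 hC)
  have hu : IsUnit (∑ i, P.linner (s i) (x i)) := by
    have h1 : ‖1 - ∑ i, P.linner (s i) (x i)‖ < 1 := by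
      rw [← hx, ← Finset.sum_sub_distrib]
      calc ‖∑ i, (P.linner (x i) (x i) - P.linner (s i) (x i))‖
          ≤ ∑ i, ‖P.linner (x i) (x i) - P.linner (s i) (x i)‖ := norm_sum_le _ _
        _ ≤ ∑ i, (∑ i, ‖x i‖ + 1)⁻¹ * ‖x i‖ := Finset.sum_le_sum fun i _ => by
            rw [← P.linner_sub_left]
            exact (P.norm_linner_le _ _).trans
              (mul_le_mul_of_nonneg_right (hsx i).le (norm_nonneg _))
        _ = (∑ i, ‖x i‖ + 1)⁻¹ * ∑ i, ‖x i‖ := by rw [Finset.mul_sum]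
        _ < 1 := by rw [inv_mul_lt_one₀ hC]; exact lt_add_one _
    simpa using (Units.oneSub _ h1).isUnit
  obtain ⟨a, ha⟩ := hu
  refine top_le_iff.1 fun p _ => ?_
  have hp : P.l (a : B) p ∈ S := by
    rw [ha, P.sum_l]
    refine S.sum_mem fun i _ => ?_
    rw [P.linner_l_eq]
    exact hr _ _ (hs i)
  have := hl (↑a⁻¹ : B) _ hp
  rwa [← P.mul_l, Units.inv_mul, P.one_l] at this

/-- Transport of a tensor map along isomorphisms. -/
def congr {M' N' P' : MoritaBimodule.{u, w} B} (f : Iso M' M) (g : Iso N' N) (h : Iso P P') :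
    TensorMap M' N' P' where
  toFun m n := h (β.toFun (f m) (g n))
  add_left m m' n := by rw [f.map_add, β.add_left, h.map_add]
  add_right m n n' := by rw [g.map_add, β.add_right, h.map_add]
  balanced m b n := by rw [f.map_r, g.map_l, β.balanced]
  map_l b m n := by rw [f.map_l, β.map_l, h.map_l]
  map_r m n b := by rw [g.map_r, β.map_r, h.map_r]
  linner_map m n m' n' := by
    rw [h.linner_map, β.linner_map, g.linner_map, ← f.map_r, f.linner_map]
  rinner_map m n m' n' := by
    rw [h.rinner_map, β.rinner_map, f.rinner_map, ← g.map_l, g.rinner_map]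
  dense := by
    refine dense_univ.mono fun p hp' => ?_
    clear hp'
    obtain ⟨p, rfl⟩ := h.toEquiv.surjective p
    have hp : p ∈ AddSubgroup.closure (Set.range fun p : M × N => β.toFun p.1 p.2) := by
      rw [β.closure_eq_top]; trivial
    induction hp using AddSubgroup.closure_induction with
    | mem p hp =>
      obtain ⟨⟨m, n⟩, rfl⟩ := hp
      obtain ⟨m, rfl⟩ := f.toEquiv.surjective m
      obtain ⟨n, rfl⟩ := g.toEquiv.surjective n
      exact Submodule.subset_span ⟨(m, n), rfl⟩
    | zero =>
      have : h.toEquiv 0 = 0 := by simpa using h.map_add 0 0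
      rw [this]; exact Submodule.zero_mem _
    | add x y _ _ hx hy => rw [h.map_add]; exact Submodule.add_mem _ hx hy
    | neg x _ hx =>
      have : h.toEquiv (-x) = -h.toEquiv x :=
        map_neg (AddMonoidHom.mk' h.toEquiv h.map_add) x
      rw [this]; exact Submodule.neg_mem _ hx

/-- The internal tensor product is unique up to isomorphism. -/
lemma nonempty_iso {P' : MoritaBimodule.{u, w} B} (β : TensorMap M N P)
    (β' : TensorMap M N P') :
    Nonempty (Iso P P') :=
  nonempty_iso_of_closure _ _ β.closure_eq_top β'.closure_eq_top
    (fun i j => by rw [β'.linner_map, β.linner_map])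
    (fun i j => by rw [β'.rinner_map, β.rinner_map])

lemma closure_left {K Q : MoritaBimodule.{u, w} B} (γ : TensorMap P K Q) :
    AddSubgroup.closure (Set.range fun p : M × N × K => γ.toFun (β.toFun p.1 p.2.1) p.2.2)
      = ⊤ := by
  rw [← top_le_iff, ← γ.closure_eq_top, AddSubgroup.closure_le]
  rintro _ ⟨⟨p, k⟩, rfl⟩
  have hp : p ∈ AddSubgroup.closure (Set.range fun p : M × N => β.toFun p.1 p.2) := by
    rw [β.closure_eq_top]; trivial
  let F : P →+ Q := AddMonoidHom.mk' (γ.toFun · k) fun x y => γ.add_left x y k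
  change F p ∈ _
  induction hp using AddSubgroup.closure_induction with
  | mem p hp =>
    obtain ⟨⟨m, n⟩, rfl⟩ := hp
    exact AddSubgroup.subset_closure ⟨(m, n, k), rfl⟩
  | zero => rw [map_zero]; exact AddSubgroup.zero_mem _
  | add x y _ _ hx hy => rw [map_add]; exact AddSubgroup.add_mem _ hx hy
  | neg x _ hx => rw [map_neg]; exact AddSubgroup.neg_mem _ hx

lemma closure_right {K Q : MoritaBimodule.{u, w} B} (γ : TensorMap K P Q) :
    AddSubgroup.closure (Set.range fun p : K × M × N => γ.toFun p.1 (β.toFun p.2.1 p.2.2))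
      = ⊤ := by
  rw [← top_le_iff, ← γ.closure_eq_top, AddSubgroup.closure_le]
  rintro _ ⟨⟨k, p⟩, rfl⟩
  have hp : p ∈ AddSubgroup.closure (Set.range fun p : M × N => β.toFun p.1 p.2) := by
    rw [β.closure_eq_top]; trivial
  let F : P →+ Q := AddMonoidHom.mk' (γ.toFun k) fun x y => γ.add_right k x y
  change F p ∈ _
  induction hp using AddSubgroup.closure_induction with
  | mem p hp =>
    obtain ⟨⟨m, n⟩, rfl⟩ := hp
    exact AddSubgroup.subset_closure ⟨(k, m, n), rfl⟩
  | zero => rw [map_zero]; exact AddSubgroup.zero_mem _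
  | add x y _ _ hx hy => rw [map_add]; exact AddSubgroup.add_mem _ hx hy
  | neg x _ hx => rw [map_neg]; exact AddSubgroup.neg_mem _ hx

/-- The internal tensor product is associative up to isomorphism. -/
lemma assoc {K MN NK Q Q' : MoritaBimodule.{u, w} B} (β : TensorMap M N MN)
    (γ : TensorMap MN K Q) (β' : TensorMap N K NK) (γ' : TensorMap M NK Q') :
    Nonempty (Iso Q Q') :=
  nonempty_iso_of_closure _ _ (β.closure_left γ) (β'.closure_right γ')
    (fun i j => by
      rw [γ'.linner_map, γ.linner_map, β'.linner_map, ← β.map_r, β.linner_map, N.linner_r_left,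
        ← N.linner_r_left])
    (fun i j => by
      rw [γ'.rinner_map, γ.rinner_map, β.rinner_map, ← β'.map_l, β'.rinner_map,
        N.rinner_l_right, ← N.rinner_l_right])

/-- `B ⊗ M ≅ M`. -/
def selfLeft (M : MoritaBimodule.{u, u} B) : TensorMap (self B) M M where
  toFun b m := M.l b m
  add_left b b' m := M.add_l b b' m
  add_right b := M.l_add b
  balanced b c m := M.mul_l b c m
  map_l c b m := M.mul_l c b m
  map_r b m c := (M.l_r b m c).symm
  linner_map := by
    have h : ∀ (b b' : B) (m m' : M),
        M.linner (M.l b m) (M.l b' m') = b * M.linner m m' * star b' := fun b b' m m' => by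
      rw [M.linner_l_left, M.linner_l_right, ← mul_assoc]
    exact fun b m b' m' => h b b' m m'
  rinner_map := by
    have h : ∀ (b b' : B) (m m' : M),
        M.rinner (M.l b m) (M.l b' m') = M.rinner m (M.l (star b * b') m') := fun b b' m m' => by
      rw [M.rinner_l_left, ← M.mul_l]
    exact fun b m b' m' => h b b' m m'
  dense := by
    refine dense_univ.mono fun m _ => Submodule.subset_span ⟨((1 : B), m), M.one_l m⟩

/-- `M̄ ⊗ M ≅ B`. -/
def dualLeft (M : MoritaBimodule.{u, u} B) : TensorMap M.dual M (self B) where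
  toFun x y := M.rinner x y
  add_left := M.rinner_add_left
  add_right := M.rinner_add_right
  balanced := by
    have h : ∀ (x : M) (b : B) (y : M), M.rinner (M.l (star b) x) y = M.rinner x (M.l b y) :=
      fun x b y => by rw [M.rinner_l_left, star_star]
    exact h
  map_l := by
    have h : ∀ (b : B) (x y : M), M.rinner (M.r x (star b)) y = b * M.rinner x y :=
      fun b x y => by rw [M.rinner_r_left, star_star]
    exact h
  map_r x y b := M.rinner_r_right x y b
  linner_map := by
    have h : ∀ x y x' y' : M, M.rinner x y * star (M.rinner x' y') =
        M.rinner (M.l (star (M.linner y y')) x) x' := fun x y x' y' => by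
      rw [M.star_rinner, M.rinner_l_left, star_star, M.linner_l_eq, M.rinner_r_right]
    exact h
  rinner_map := by
    have h : ∀ x y x' y' : M, star (M.rinner x y) * M.rinner x' y' =
        M.rinner y (M.l (M.linner x x') y') := fun x y x' y' => by
      rw [M.linner_l_eq, M.rinner_r_right, M.star_rinner]
    exact h
  dense := M.rinner_full

end TensorMap
/-! ### Existence of the internal tensor product

For unital `B` the internal tensor product of `M` and `N` is realized on the space of additive maps
`f : M → N` with `f (y b) = b⋆ f(y)`, with `m ⊗ n` given by `y ↦ ⟨y, m⟩ᵣ n`. -/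

section Model

lemma norm_le_aux {E : Type w} [AddCommGroup E] (lin : E → E → B) (l : B → E → E)
    (r : E → B → E) (x : E) (c : B)
    (hl : ∀ a x y, lin (l a x) y = a * lin x y) (hs : ∀ x y, star (lin x y) = lin y x)
    (hr : ∀ x b y, lin (r x b) y = lin x (r y (star b))) (hm : ∀ x a b, r x (a * b) = r (r x a) b)
    (ha : ∀ x y z, lin (x + y) z = lin x z + lin y z) (hra : ∀ x a b, r x (a + b) = r x a + r x b)
    (hz : ∀ x y (z : ℂ), lin (r x (z • 1)) y = z • lin x y)
    (hp : ∀ x, ∃ b, lin x x = star b * b) (hc : l (lin x x) x = r x c) :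
    ‖lin x x‖ ≤ ‖c‖ := by
  let _ := CStarAlgebra.spectralOrder B
  have _ := CStarAlgebra.spectralOrderedRing B
  have hp' : ∀ x, 0 ≤ lin x x := fun x => CStarAlgebra.nonneg_iff_eq_star_mul_self.2 (hp x)
  set a := lin x x with hA
  have hsa : star a = a := hs x x
  have h1 : a * (a * a) = lin (r x (c * star c)) x := by
    rw [hm, hr, star_star, ← hc, hl, ← hs, hl, ← hA, star_mul, hsa]
  have h2 : a * (a * a) ≤ ((‖c‖ ^ 2 : ℝ) : ℂ) • a := by
    have h3 : (0 : B) ≤ algebraMap ℝ B (‖c‖ ^ 2) - c * star c :=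
      sub_nonneg.2 CStarAlgebra.mul_star_le_algebraMap_norm_sq
    obtain ⟨e, he⟩ := CStarAlgebra.nonneg_iff_eq_star_mul_self.1 h3
    have h4 : ((‖c‖ ^ 2 : ℝ) : ℂ) • (1 : B) = c * star c + star e * e := by
      rw [← he, add_sub_cancel, Algebra.algebraMap_eq_smul_one, Complex.coe_smul]
    have h5 : ((‖c‖ ^ 2 : ℝ) : ℂ) • a = a * (a * a) + lin (r x (star e)) (r x (star e)) := by
      rw [h1, ← hz, h4, hra, ha]
      congr 1
      rw [hm, hr]
    rw [h5]
    exact le_add_of_nonneg_right (hp' _)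
  have h6 : ‖a‖ ^ 3 ≤ ‖c‖ ^ 2 * ‖a‖ := by
    have h7 : ‖a * (a * a)‖ ≤ ‖((‖c‖ ^ 2 : ℝ) : ℂ) • a‖ := by
      refine CStarAlgebra.norm_le_norm_of_nonneg_of_le ?_ h2
      have := star_left_conjugate_nonneg (hp' x) a
      rwa [hsa, mul_assoc] at this
    rw [norm_smul, Complex.norm_real, Real.norm_of_nonneg (sq_nonneg _)] at h7
    refine le_trans (le_of_eq ?_) h7
    have h8 : ‖a * a‖ = ‖a‖ * ‖a‖ := by
      nth_rewrite 1 [← hsa]; exact CStarRing.norm_star_mul_self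
    have h9 : ‖a * a * (a * a)‖ = ‖a‖ ^ 4 := by
      have : ‖star (a * a) * (a * a)‖ = ‖a * a‖ * ‖a * a‖ := CStarRing.norm_star_mul_self
      rw [star_mul, hsa] at this
      rw [this, h8]; ring
    refine le_antisymm ?_ ?_
    · by_cases h0 : ‖a‖ = 0
      · rw [h0]; simp
      · have h10 : ‖a‖ ^ 4 ≤ ‖a‖ * ‖a * (a * a)‖ := by
          rw [← h9, mul_assoc]; exact norm_mul_le _ _
        have h11 : 0 < ‖a‖ := lt_of_le_of_ne (norm_nonneg _) (Ne.symm h0)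
        exact le_of_mul_le_mul_left (by linarith [h10, show ‖a‖ * ‖a‖ ^ 3 = ‖a‖ ^ 4 by ring]) h11
    · calc ‖a * (a * a)‖ ≤ ‖a‖ * ‖a * a‖ := norm_mul_le _ _
        _ = ‖a‖ ^ 3 := by rw [h8]; ring
  by_contra! hlt
  have h0 : 0 < ‖a‖ := (norm_nonneg c).trans_lt hlt
  have : ‖c‖ ^ 2 * ‖a‖ < ‖a‖ ^ 3 := by
    have : ‖c‖ ^ 2 < ‖a‖ ^ 2 := pow_lt_pow_left₀ hlt (norm_nonneg _) two_ne_zero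
    calc ‖c‖ ^ 2 * ‖a‖ < ‖a‖ ^ 2 * ‖a‖ := mul_lt_mul_of_pos_right this h0
      _ = ‖a‖ ^ 3 := by ring
  linarith

variable (M N : MoritaBimodule.{u, w} B)

/-- Additive maps `f : M → N` with `f (y b) = b⋆ f(y)`. -/
def model : Submodule ℂ (M → N) where
  carrier := {f | (∀ x y, f (x + y) = f x + f y) ∧ ∀ x b, f (M.r x b) = N.l (star b) (f x)}
  add_mem' := fun {f g} hf hg => ⟨fun x y => by
      simp only [Pi.add_apply, hf.1, hg.1]; exact add_add_add_comm _ _ _ _,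
    fun x b => by simp only [Pi.add_apply, hf.2, hg.2, N.l_add]⟩
  zero_mem' := ⟨fun x y => by simp, fun x b => by simp [N.l_zero]⟩
  smul_mem' := fun z f hf => ⟨fun x y => by simp only [Pi.smul_apply, hf.1, smul_add],
    fun x b => by simp only [Pi.smul_apply, hf.2, N.l_smul]⟩

variable {M N}

namespace model

lemma map_sum (f : model M N) {κ : Type*} (s : Finset κ) (y : κ → M) :
    f.1 (∑ i ∈ s, y i) = ∑ i ∈ s, f.1 (y i) :=
  _root_.map_sum (AddMonoidHom.mk' f.1 f.2.1) y s

/-- The elementary tensor `m ⊗ n`. -/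
def theta (m : M) (n : N) : model M N :=
  ⟨fun y => N.l (M.rinner y m) n, fun x y => by
    beta_reduce; rw [M.rinner_add_left, N.add_l],
    fun x b => by beta_reduce; rw [M.rinner_r_left, N.mul_l]⟩

lemma theta_add_left (m m' : M) (n : N) : theta (m + m') n = theta m n + theta m' n :=
  Subtype.ext (funext fun y => by
    change N.l (M.rinner y (m + m')) n = N.l (M.rinner y m) n + N.l (M.rinner y m') n
    rw [M.rinner_add_right, N.add_l])

lemma theta_add_right (m : M) (n n' : N) : theta m (n + n') = theta m n + theta m n' :=
  Subtype.ext (funext fun _ => N.l_add _ n n')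

lemma theta_balanced (m : M) (b : B) (n : N) : theta (M.r m b) n = theta m (N.l b n) :=
  Subtype.ext (funext fun y => by
    change N.l (M.rinner y (M.r m b)) n = N.l (M.rinner y m) (N.l b n)
    rw [M.rinner_r_right, N.mul_l])

/-- The left action. -/
def l (a : B) (f : model M N) : model M N :=
  ⟨fun y => f.1 (M.l (star a) y), fun x y => by
    beta_reduce; rw [M.l_add, f.2.1],
    fun x b => by beta_reduce; rw [← M.l_r, f.2.2]⟩

/-- The right action. -/
def r (f : model M N) (b : B) : model M N :=
  ⟨fun y => N.r (f.1 y) b, fun x y => by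
    beta_reduce; rw [f.2.1, N.add_r],
    fun x c => by beta_reduce; rw [f.2.2, N.l_r]⟩

lemma l_theta (a : B) (m : M) (n : N) : l a (theta m n) = theta (M.l a m) n :=
  Subtype.ext (funext fun y => by
    change N.l (M.rinner (M.l (star a) y) m) n = N.l (M.rinner y (M.l a m)) n
    rw [M.rinner_l_left, star_star])

lemma r_theta (m : M) (n : N) (b : B) : r (theta m n) b = theta m (N.r n b) :=
  Subtype.ext (funext fun _ => N.l_r _ n b)

lemma l_add (a : B) (f g : model M N) : l a (f + g) = l a f + l a g := rfl

lemma r_add_left (f g : model M N) (b : B) : r (f + g) b = r f b + r g b :=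
  Subtype.ext (funext fun _ => N.add_r _ _ _)

variable {ι : Type} [Fintype ι] (x : ι → M)

/-- The left inner product, through a frame `x`. -/
def linner (f g : model M N) : B :=
  ∑ i, ∑ j, M.linner (M.r (x i) (N.linner (f.1 (x i)) (g.1 (x j)))) (x j)

/-- The right inner product, through a frame `x`. -/
def rinner (f g : model M N) : B := ∑ i, N.rinner (f.1 (x i)) (g.1 (x i))

lemma linner_add_left (f f' g : model M N) :
    linner x (f + f') g = linner x f g + linner x f' g := by
  simp only [linner, ← Finset.sum_add_distrib]
  refine Finset.sum_congr rfl fun i _ => Finset.sum_congr rfl fun j _ => ?_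
  change M.linner (M.r (x i) (N.linner (f.1 (x i) + f'.1 (x i)) _)) _ = _
  rw [N.linner_add_left, M.r_add, M.linner_add_left]

lemma star_linner (f g : model M N) : star (linner x f g) = linner x g f := by
  simp only [linner, star_sum]
  rw [Finset.sum_comm]
  refine Finset.sum_congr rfl fun i _ => Finset.sum_congr rfl fun j _ => ?_
  rw [M.star_linner, M.linner_r_right, N.star_linner]

lemma linner_add_right (f g g' : model M N) :
    linner x f (g + g') = linner x f g + linner x f g' := by
  rw [← star_linner, linner_add_left, star_add, star_linner, star_linner]

lemma rinner_add_right (f g g' : model M N) :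
    rinner x f (g + g') = rinner x f g + rinner x f g' := by
  simp only [rinner, ← Finset.sum_add_distrib]
  exact Finset.sum_congr rfl fun i _ => N.rinner_add_right _ _ _

lemma star_rinner (f g : model M N) : star (rinner x f g) = rinner x g f := by
  simp only [rinner, star_sum, N.star_rinner]

lemma rinner_add_left (f f' g : model M N) :
    rinner x (f + f') g = rinner x f g + rinner x f' g := by
  rw [← star_rinner, rinner_add_right, star_add, star_rinner, star_rinner]

lemma rinner_r_right (f g : model M N) (b : B) : rinner x f (r g b) = rinner x f g * b := by
  simp only [rinner, Finset.sum_mul]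
  exact Finset.sum_congr rfl fun i _ => N.rinner_r_right _ _ _

lemma linner_r_left (f : model M N) (b : B) (g : model M N) :
    linner x (r f b) g = linner x f (r g (star b)) := by
  simp only [linner]
  refine Finset.sum_congr rfl fun i _ => Finset.sum_congr rfl fun j _ => ?_
  change M.linner (M.r (x i) (N.linner (N.r (f.1 (x i)) b) (g.1 (x j)))) (x j) = _
  rw [N.linner_r_left]; rfl

lemma sum_nonneg_aux {κ : Type*} (s : Finset κ) (f : κ → B) (h : ∀ i, ∃ b, f i = star b * b) :
    ∃ b, ∑ i ∈ s, f i = star b * b := by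
  let _ := CStarAlgebra.spectralOrder B
  have _ := CStarAlgebra.spectralOrderedRing B
  exact CStarAlgebra.nonneg_iff_eq_star_mul_self.1
    (Finset.sum_nonneg fun i _ => CStarAlgebra.nonneg_iff_eq_star_mul_self.2 (h i))

lemma rinner_self_nonneg (f : model M N) : ∃ b, rinner x f f = star b * b :=
  sum_nonneg_aux _ _ fun _ => N.rinner_self_nonneg _

lemma linner_self_nonneg (f : model M N) : ∃ b, linner x f f = star b * b := by
  obtain ⟨κ, _, z, hz⟩ := N.exists_frame'
  have h : linner x f f = ∑ k, M.linner (∑ i, M.r (x i) (N.linner (f.1 (x i)) (z k)))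
      (∑ i, M.r (x i) (N.linner (f.1 (x i)) (z k))) := by
    simp_rw [M.linner_sum_left, M.linner_sum_right]
    rw [linner]
    conv_rhs => rw [Finset.sum_comm]
    refine Finset.sum_congr rfl fun i _ => ?_
    conv_rhs => rw [Finset.sum_comm]
    refine Finset.sum_congr rfl fun j _ => ?_
    have : N.linner (f.1 (x i)) (f.1 (x j)) =
        ∑ k, N.linner (f.1 (x i)) (z k) * N.linner (z k) (f.1 (x j)) := by
      simp_rw [← N.linner_l_left, N.linner_l_eq]
      rw [← N.linner_sum_left, ← N.r_sum, hz, N.r_one]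
    rw [this, M.r_sum, M.linner_sum_left]
    refine Finset.sum_congr rfl fun k _ => ?_
    rw [M.linner_r_right, N.star_linner, M.r_mul]
  rw [h]
  exact sum_nonneg_aux _ _ fun _ => M.linner_self_nonneg _

variable {x}

lemma eq_sum_theta (hx : ∑ i, M.linner (x i) (x i) = 1)
    (f : model M N) : f = ∑ i, theta (x i) (f.1 (x i)) := by
  refine Subtype.ext (funext fun y => ?_)
  have h1 : (∑ i, theta (x i) (f.1 (x i))).1 y = ∑ i, (theta (x i) (f.1 (x i))).1 y := by
    simp [Finset.sum_apply]
  rw [h1]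
  nth_rewrite 1 [← frame_sum hx y]
  rw [map_sum]
  refine Finset.sum_congr rfl fun i _ => ?_
  rw [f.2.2, M.star_rinner]; rfl

lemma theta_induction (hx : ∑ i, M.linner (x i) (x i) = 1)
    {p : model M N → Prop} (h0 : p 0) (ha : ∀ f g, p f → p g → p (f + g))
    (ht : ∀ m n, p (theta m n)) (f : model M N) : p f := by
  rw [eq_sum_theta hx f]
  exact Finset.sum_induction _ p ha h0 fun i _ => ht _ _

lemma rinner_theta (hx : ∑ i, M.linner (x i) (x i) = 1)
    (m : M) (n : N) (g : model M N) :
    rinner x (theta m n) g = N.rinner n (g.1 m) := by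
  have h : ∀ i, N.rinner (N.l (M.rinner (x i) m) n) (g.1 (x i)) =
      N.rinner n (g.1 (M.r (x i) (M.rinner (x i) m))) := fun i => by
    rw [N.rinner_l_left, g.2.2]
  change ∑ i, N.rinner (N.l (M.rinner (x i) m) n) (g.1 (x i)) = _
  simp_rw [h]
  rw [← N.rinner_sum_right, ← map_sum, frame_sum hx]

lemma rinner_theta_theta (hx : ∑ i, M.linner (x i) (x i) = 1)
    (m m' : M) (n n' : N) :
    rinner x (theta m n) (theta m' n') = N.rinner n (N.l (M.rinner m m') n') :=
  rinner_theta hx m n _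

lemma linner_theta (hx : ∑ i, M.linner (x i) (x i) = 1)
    (m : M) (n : N) (g : model M N) : linner x (theta m n) g =
    ∑ j, M.linner (M.r m (N.linner n (g.1 (x j)))) (x j) := by
  rw [linner, Finset.sum_comm]
  refine Finset.sum_congr rfl fun j _ => ?_
  rw [← M.linner_sum_left]
  congr 1
  nth_rewrite 2 [← frame_sum hx m]
  rw [M.sum_r]
  refine Finset.sum_congr rfl fun i _ => ?_
  rw [← M.r_mul, ← N.linner_l_left]; rfl

lemma linner_theta_theta (hx : ∑ i, M.linner (x i) (x i) = 1)
    (m m' : M) (n n' : N) :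
    linner x (theta m n) (theta m' n') = M.linner (M.r m (N.linner n n')) m' := by
  rw [linner_theta hx]
  nth_rewrite 2 [← frame_sum hx m']
  rw [M.linner_sum_right]
  refine Finset.sum_congr rfl fun j _ => ?_
  rw [M.linner_r_right, M.star_rinner, ← M.r_mul]
  change M.linner (M.r m (N.linner n (N.l (M.rinner (x j) m') n'))) _ = _
  rw [N.linner_l_right, M.star_rinner]

lemma linner_l_left (hx : ∑ i, M.linner (x i) (x i) = 1)
    (a : B) (f g : model M N) : linner x (l a f) g = a * linner x f g := by
  have h0 : linner x 0 g = 0 := by simpa using linner_add_left x 0 0 g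
  induction f using theta_induction hx with
  | h0 => change linner x 0 g = _; rw [h0, mul_zero]
  | ha f f' hf hf' => rw [l_add, linner_add_left, hf, hf', linner_add_left, mul_add]
  | ht m n =>
    rw [l_theta, linner_theta hx, linner_theta hx, Finset.mul_sum]
    exact Finset.sum_congr rfl fun j _ => by rw [M.l_r, M.linner_l_left]

lemma rinner_l_left (hx : ∑ i, M.linner (x i) (x i) = 1)
    (a : B) (f g : model M N) :
    rinner x (l a f) g = rinner x f (l (star a) g) := by
  have h0 : ∀ g : model M N, rinner x 0 g = 0 := fun g => by simpa using rinner_add_left x 0 0 g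
  induction f using theta_induction hx with
  | h0 => change rinner x 0 g = _; rw [h0, h0]
  | ha f f' hf hf' => rw [l_add, rinner_add_left, hf, hf', rinner_add_left]
  | ht m n =>
    rw [l_theta, rinner_theta hx, rinner_theta hx]
    change _ = N.rinner n (g.1 (M.l (star (star a)) m))
    rw [star_star]

lemma linner_l_eq (hx : ∑ i, M.linner (x i) (x i) = 1)
    (f g h : model M N) : l (linner x f g) h = r f (rinner x g h) := by
  have hl0 : ∀ g : model M N, linner x 0 g = 0 := fun g => by simpa using linner_add_left x 0 0 g
  have hl0' : ∀ g : model M N, linner x g 0 = 0 := fun g => by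
    simpa using linner_add_right x g 0 0
  have hr0 : ∀ g : model M N, rinner x 0 g = 0 := fun g => by simpa using rinner_add_left x 0 0 g
  have hadd : ∀ a b (h : model M N), l (a + b) h = l a h + l b h := fun a b h =>
    Subtype.ext (funext fun y => by
      change h.1 (M.l (star (a + b)) y) = h.1 (M.l (star a) y) + h.1 (M.l (star b) y)
      rw [star_add, M.add_l, h.2.1])
  have hradd : ∀ (f : model M N) a b, r f (a + b) = r f a + r f b := fun f a b =>
    Subtype.ext (funext fun _ => N.r_add _ a b)
  have hl00 : l 0 h = 0 := by simpa using hadd 0 0 h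
  have hr00 : ∀ f : model M N, r f 0 = 0 := fun f => by simpa using hradd f 0 0
  have hr01 : ∀ b, r (0 : model M N) b = 0 := fun b => by
    have := r_add_left (0 : model M N) 0 b
    rw [add_zero] at this
    exact left_eq_add.1 this
  induction f using theta_induction hx with
  | h0 => rw [hl0, hl00, hr01]
  | ha f f' hf hf' => rw [linner_add_left, hadd, hf, hf', r_add_left]
  | ht m n =>
    induction g using theta_induction hx with
    | h0 => rw [hl0', hl00, hr0, hr00]
    | ha g g' hg hg' => rw [linner_add_right, hadd, hg, hg', rinner_add_left, hradd]
    | ht m' n' =>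
      rw [linner_theta_theta hx, rinner_theta hx, r_theta, ← N.linner_l_eq, ← theta_balanced]
      refine Subtype.ext (funext fun y => ?_)
      change h.1 (M.l (star (M.linner (M.r m (N.linner n n')) m')) y) =
        N.l (M.rinner y (M.r m (N.linner n n'))) (h.1 m')
      rw [M.star_linner, M.linner_l_eq, h.2.2, M.star_rinner]

lemma linner_smul (f g : model M N) (z : ℂ) : linner x (z • f) g = z • linner x f g := by
  simp only [linner, Finset.smul_sum]
  refine Finset.sum_congr rfl fun i _ => Finset.sum_congr rfl fun j _ => ?_
  change M.linner (M.r (x i) (N.linner (z • f.1 (x i)) (g.1 (x j)))) (x j) = _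
  rw [N.linner_smul_left, M.r_smul, M.linner_smul_left]

lemma l_mul (a b : B) (f : model M N) : l (a * b) f = l a (l b f) :=
  Subtype.ext (funext fun y => by
    change f.1 (M.l (star (a * b)) y) = f.1 (M.l (star b) (M.l (star a) y))
    rw [star_mul, M.mul_l])

lemma add_l (a b : B) (f : model M N) : l (a + b) f = l a f + l b f :=
  Subtype.ext (funext fun y => by
    change f.1 (M.l (star (a + b)) y) = f.1 (M.l (star a) y) + f.1 (M.l (star b) y)
    rw [star_add, M.add_l, f.2.1])

lemma one_l (f : model M N) : l 1 f = f :=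
  Subtype.ext (funext fun y => by
    change f.1 (M.l (star 1) y) = f.1 y
    rw [star_one, M.one_l])

lemma smul_l (a : B) (z : ℂ) (f : model M N) : l (z • a) f = z • l a f :=
  Subtype.ext (funext fun y => by
    change f.1 (M.l (star (z • a)) y) = z • f.1 (M.l (star a) y)
    rw [star_smul, M.smul_l, ← M.r_smul_eq, f.2.2, star_smul, star_star, star_one, N.smul_l,
      N.one_l])

lemma r_smul (z : ℂ) (f : model M N) (b : B) : r f (z • b) = z • r f b :=
  Subtype.ext (funext fun _ => N.r_smul z _ b)

lemma r_add (f : model M N) (a b : B) : r f (a + b) = r f a + r f b :=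
  Subtype.ext (funext fun _ => N.r_add _ a b)

lemma r_mul (f : model M N) (a b : B) : r f (a * b) = r (r f a) b :=
  Subtype.ext (funext fun _ => N.r_mul _ a b)

lemma norm_linner_eq (hx : ∑ i, M.linner (x i) (x i) = 1) (f : model M N) :
    ‖linner x f f‖ = ‖rinner x f f‖ := by
  have h1 : ∀ f : model M N, r f 1 = f := fun f => Subtype.ext (funext fun _ => N.r_one _)
  apply le_antisymm
  · refine norm_le_aux (linner x) l r f _ (linner_l_left hx) (star_linner x)
      (linner_r_left x) r_mul (linner_add_left x) r_add (fun f g z => ?_) (linner_self_nonneg x)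
      (linner_l_eq hx _ _ _)
    rw [r_smul, h1, linner_smul]
  · refine norm_le_aux (rinner x) (fun b f => r f (star b)) (fun f b => l (star b) f) f _
      (fun a f g => ?_) (star_rinner x) (fun f b g => rinner_l_left hx _ _ _)
      (fun f a b => by rw [star_mul, l_mul]) (rinner_add_left x)
      (fun f a b => by rw [star_add, add_l]) (fun f g z => ?_) (rinner_self_nonneg x) ?_
    · rw [← star_rinner, rinner_r_right, star_mul, star_star, star_rinner]
    · rw [star_smul, star_one, rinner_l_left hx, star_smul, star_star, star_one, smul_l, one_l]
      have := rinner_r_right x f g (z • 1)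
      rwa [r_smul, h1, mul_smul_comm, mul_one] at this
    · rw [star_rinner, star_linner, linner_l_eq hx]

lemma norm_apply_le (f : model M N) (i : ι) : ‖f.1 (x i)‖ ^ 2 ≤ ‖rinner x f f‖ := by
  let _ := CStarAlgebra.spectralOrder B
  have _ := CStarAlgebra.spectralOrderedRing B
  have hp : ∀ i, 0 ≤ N.rinner (f.1 (x i)) (f.1 (x i)) := fun i =>
    CStarAlgebra.nonneg_iff_eq_star_mul_self.2 (N.rinner_self_nonneg _)
  rw [N.norm_sq_eq_rinner]
  exact CStarAlgebra.norm_le_norm_of_nonneg_of_le (hp i)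
    (Finset.single_le_sum (f := fun i => N.rinner (f.1 (x i)) (f.1 (x i)))
      (fun i _ => hp i) (Finset.mem_univ i))

end model

lemma norm_r_le (M : MoritaBimodule.{u, w} B) (m : M) (b : B) : ‖M.r m b‖ ≤ ‖m‖ * ‖b‖ := by
  refine le_of_sq_le_sq ?_ (by positivity)
  rw [M.norm_sq_eq_rinner, M.rinner_r_right, M.rinner_r_left, mul_pow, M.norm_sq_eq_rinner m]
  calc ‖star b * M.rinner m m * b‖ ≤ ‖star b‖ * ‖M.rinner m m‖ * ‖b‖ :=
        (norm_mul_le _ _).trans (mul_le_mul_of_nonneg_right (norm_mul_le _ _) (norm_nonneg _))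
    _ = ‖M.rinner m m‖ * ‖b‖ ^ 2 := by rw [norm_star]; ring

variable (M N) in
theorem exists_tensorMap : ∃ P : MoritaBimodule.{u, w} B, Nonempty (TensorMap M N P) := by
  obtain ⟨ι, _, x, hx⟩ := M.exists_frame
  let _ := CStarAlgebra.spectralOrder B
  have _ := CStarAlgebra.spectralOrderedRing B
  have hdef : ∀ f : model M N, model.linner x f f = 0 → f = 0 := by
    intro f hf
    have h1 : ∀ i, f.1 (x i) = 0 := fun i => by
      have h2 := model.norm_apply_le (x := x) f i
      rw [← model.norm_linner_eq hx, hf, norm_zero] at h2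
      exact norm_eq_zero.1 (pow_eq_zero_iff two_ne_zero |>.1 (le_antisymm h2 (sq_nonneg _)))
    rw [model.eq_sum_theta hx f]
    refine Finset.sum_eq_zero fun i _ => ?_
    rw [h1]
    exact Subtype.ext (funext fun y => N.l_zero _)
  let _ : SMul B (model M N) := ⟨model.l⟩
  let _ : Norm (model M N) := ⟨fun f => √‖model.linner x f f‖⟩
  let _ : CStarModule B (model M N) :=
    { inner := fun f g => model.linner x g f
      inner_add_right := model.linner_add_left x _ _ _
      inner_self_nonneg :=
        CStarAlgebra.nonneg_iff_eq_star_mul_self.2 (model.linner_self_nonneg x _)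
      inner_self := fun {f} => ⟨hdef f, fun h => by
        subst h; simpa using model.linner_add_left x (0 : model M N) 0 0⟩
      inner_op_smul_right := model.linner_l_left hx _ _ _
      inner_smul_right_complex := model.linner_smul _ _ _
      star_inner := fun f g => model.star_linner x g f
      norm_eq_sqrt_norm_inner_self := fun _ => rfl }
  let nacg : NormedAddCommGroup (model M N) :=
    NormedAddCommGroup.ofCore (CStarModule.normedSpaceCore B)
  let ns : NormedSpace ℂ (model M N) := NormedSpace.ofCore (CStarModule.normedSpaceCore B)
  have hnl : ∀ f : model M N, ‖f‖ ^ 2 = ‖model.linner x f f‖ := fun f =>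
    Real.sq_sqrt (norm_nonneg _)
  have hnr : ∀ f : model M N, ‖f‖ ^ 2 = ‖model.rinner x f f‖ := fun f => by
    rw [hnl, model.norm_linner_eq hx]
  have hev : ∀ (f : model M N) i, ‖f.1 (x i)‖ ≤ ‖f‖ := fun f i => by
    refine le_of_sq_le_sq ?_ (norm_nonneg _)
    rw [hnr]; exact model.norm_apply_le f i
  have hth : ∀ (m : M) (n : N), ‖model.theta m n‖ ≤ ‖m‖ * ‖n‖ := fun m n => by
    refine le_of_sq_le_sq ?_ (by positivity)
    rw [hnl, model.linner_theta_theta hx]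
    calc _ ≤ ‖M.r m (N.linner n n)‖ * ‖m‖ := M.norm_linner_le _ _
      _ ≤ ‖m‖ * ‖N.linner n n‖ * ‖m‖ :=
        mul_le_mul_of_nonneg_right (M.norm_r_le _ _) (norm_nonneg _)
      _ = (‖m‖ * ‖n‖) ^ 2 := by rw [← N.norm_sq_eq_linner]; ring
  let ps : PseudoMetricSpace (model M N) := nacg.toMetricSpace.toPseudoMetricSpace
  have hcomp : @CompleteSpace (model M N) ps.toUniformSpace := by
    refine @Metric.complete_of_cauchySeq_tendsto (model M N) ps fun v hv => ?_
    have h1 : ∀ i, ∃ t, Filter.Tendsto (fun k => (v k).1 (x i)) Filter.atTop (nhds t) :=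
      fun i => by
        refine cauchySeq_tendsto_of_complete ?_
        rw [@Metric.cauchySeq_iff (model M N) _ ps] at hv
        rw [Metric.cauchySeq_iff]
        intro ε hε
        obtain ⟨K, hK⟩ := hv ε hε
        refine ⟨K, fun k hk k' hk' => lt_of_le_of_lt ?_ (hK k hk k' hk')⟩
        rw [dist_eq_norm, dist_eq_norm]
        exact hev (v k - v k') i
    choose t ht using h1
    refine ⟨∑ i, model.theta (x i) (t i), ?_⟩
    rw [tendsto_iff_norm_sub_tendsto_zero]
    have h2 : Filter.Tendsto (fun k => ∑ i, ‖x i‖ * ‖(v k).1 (x i) - t i‖) Filter.atTop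
        (nhds 0) := by
      have : Filter.Tendsto (fun k => ∑ i, ‖x i‖ * ‖(v k).1 (x i) - t i‖) Filter.atTop
          (nhds (∑ i, ‖x i‖ * 0)) := tendsto_finsetSum _ fun i _ =>
        (tendsto_iff_norm_sub_tendsto_zero.1 (ht i)).const_mul _
      simpa using this
    refine squeeze_zero (fun _ => norm_nonneg _) (fun k => ?_) h2
    have h3 : v k - ∑ i, model.theta (x i) (t i) =
        ∑ i, model.theta (x i) ((v k).1 (x i) - t i) := by
      rw [sub_eq_iff_eq_add, ← Finset.sum_add_distrib]
      nth_rewrite 1 [model.eq_sum_theta hx (v k)]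
      refine Finset.sum_congr rfl fun i _ => ?_
      rw [← model.theta_add_right, sub_add_cancel]
    rw [h3]
    exact (norm_sum_le _ _).trans (Finset.sum_le_sum fun i _ => hth _ _)
  let P : MoritaBimodule.{u, w} B :=
    { carrier := model M N
      normedAddCommGroup := nacg
      normedSpace := ns
      completeSpace := hcomp
      l := model.l
      r := model.r
      l_add := model.l_add
      add_l := model.add_l
      l_smul := fun a z f => rfl
      smul_l := model.smul_l
      mul_l := model.l_mul
      one_l := model.one_l
      add_r := model.r_add_left
      r_add := model.r_add
      smul_r := fun z f b => Subtype.ext (funext fun _ => N.smul_r z _ b)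
      r_smul := model.r_smul
      r_mul := model.r_mul
      r_one := fun f => Subtype.ext (funext fun _ => N.r_one _)
      l_r := fun a f b => rfl
      linner := model.linner x
      rinner := model.rinner x
      linner_add_left := model.linner_add_left x
      linner_l_left := model.linner_l_left hx
      star_linner := model.star_linner x
      linner_self_nonneg := model.linner_self_nonneg x
      norm_sq_eq_linner := hnl
      linner_full := by
        refine M.linner_full.mono (Submodule.span_le.2 ?_)
        rintro _ ⟨⟨m, m'⟩, rfl⟩
        obtain ⟨κ, _, z, hz⟩ := N.exists_frame
        have : M.linner m m' =
            ∑ k, model.linner x (model.theta m (z k)) (model.theta m' (z k)) := by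
          simp_rw [model.linner_theta_theta hx]
          rw [← M.linner_sum_left, ← M.r_sum, hz, M.r_one]
        change M.linner m m' ∈ _
        rw [this]
        exact Submodule.sum_mem _ fun k _ => Submodule.subset_span ⟨(_, _), rfl⟩
      rinner_add_right := model.rinner_add_right x
      rinner_r_right := model.rinner_r_right x
      star_rinner := model.star_rinner x
      rinner_self_nonneg := model.rinner_self_nonneg x
      norm_sq_eq_rinner := hnr
      rinner_full := by
        refine N.rinner_full.mono (Submodule.span_le.2 ?_)
        rintro _ ⟨⟨n, n'⟩, rfl⟩
        obtain ⟨κ, _, z, hz⟩ := M.exists_frame'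
        have : N.rinner n n' =
            ∑ k, model.rinner x (model.theta (z k) n) (model.theta (z k) n') := by
          simp_rw [model.rinner_theta_theta hx]
          rw [← N.rinner_sum_right, ← N.sum_l, hz, N.one_l]
        change N.rinner n n' ∈ _
        rw [this]
        exact Submodule.sum_mem _ fun k _ => Submodule.subset_span ⟨(_, _), rfl⟩
      rinner_l_left := model.rinner_l_left hx
      linner_r_left := model.linner_r_left x
      linner_l_eq := model.linner_l_eq hx }
  exact ⟨P, ⟨
    { toFun := model.theta
      add_left := model.theta_add_left
      add_right := model.theta_add_right
      balanced := model.theta_balanced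
      map_l := fun b m n => (model.l_theta b m n).symm
      map_r := fun m n b => (model.r_theta m n b).symm
      linner_map := fun m n m' n' => model.linner_theta_theta hx m m' n n'
      rinner_map := fun m n m' n' => model.rinner_theta_theta hx m m' n n'
      dense := by
        intro f
        refine @subset_closure _ ps.toUniformSpace.toTopologicalSpace _ f ?_
        rw [model.eq_sum_theta hx f]
        exact Submodule.sum_mem _ fun i _ => Submodule.subset_span ⟨(x i, f.1 (x i)), rfl⟩ }⟩⟩

end Model

/-- The internal tensor product `M ⊗ N` over `B`. -/
noncomputable def tensor (M N : MoritaBimodule.{u, w} B) : MoritaBimodule.{u, w} B :=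
  (exists_tensorMap M N).choose

/-- The canonical map `M × N → M ⊗ N`. -/
noncomputable def tensorMap (M N : MoritaBimodule.{u, w} B) : TensorMap M N (tensor M N) :=
  (exists_tensorMap M N).choose_spec.some

/-- The elementary tensor `m ⊗ n`. -/
noncomputable def tmul {M N : MoritaBimodule.{u, w} B} (m : M) (n : N) : tensor M N :=
  (tensorMap M N).toFun m n

instance setoid (B : Type u) [CStarAlgebra B] : Setoid (MoritaBimodule.{u, u} B) where
  r M N := Nonempty (Iso M N)
  iseqv :=
    { refl := fun M => ⟨Iso.refl M⟩
      symm := fun ⟨f⟩ => ⟨f.symm⟩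
      trans := fun ⟨f⟩ ⟨g⟩ => ⟨f.trans g⟩ }

end MoritaBimodule

/-! ## The Picard group -/

open MoritaBimodule

/-- The Picard group: isomorphism classes of Morita equivalence `B`-bimodules. -/
def Pic (B : Type u) [CStarAlgebra B] : Type (u + 1) := Quotient (MoritaBimodule.setoid B)

namespace Pic

variable {B : Type u} [CStarAlgebra B]

/-- The class of a Morita equivalence bimodule. -/
def mk (M : MoritaBimodule.{u, u} B) : Pic B := Quotient.mk _ M

lemma mk_eq_mk {M N : MoritaBimodule.{u, u} B} : mk M = mk N ↔ Nonempty (Iso M N) :=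
  Quotient.eq

noncomputable instance : One (Pic B) := ⟨mk (self B)⟩

/-- Multiplication is given by the internal tensor product. -/
noncomputable instance : Mul (Pic B) :=
  ⟨Quotient.map₂ tensor fun _ _ ⟨f⟩ _ _ ⟨g⟩ =>
    TensorMap.nonempty_iso (tensorMap _ _) ((tensorMap _ _).congr f g (Iso.refl _))⟩

instance : Inv (Pic B) := ⟨Quotient.map dual fun _ _ ⟨f⟩ => ⟨f.dual⟩⟩

lemma mk_mul_mk (M N : MoritaBimodule.{u, u} B) : mk M * mk N = mk (tensor M N) := rfl

lemma mk_mul_mk_eq {M N P : MoritaBimodule.{u, u} B} (β : TensorMap M N P) :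
    mk M * mk N = mk P :=
  mk_eq_mk.2 (TensorMap.nonempty_iso (tensorMap M N) β)

noncomputable instance : Group (Pic B) :=
  Group.ofLeftAxioms
    (by
      rintro ⟨M⟩ ⟨N⟩ ⟨K⟩
      exact mk_eq_mk.2 (TensorMap.assoc (tensorMap M N) (tensorMap _ K) (tensorMap N K)
        (tensorMap M _)))
    (by
      rintro ⟨M⟩
      exact mk_mul_mk_eq (TensorMap.selfLeft M))
    (by
      rintro ⟨M⟩
      exact mk_mul_mk_eq (TensorMap.dualLeft M))

end Pic

/-! ## The action of the Picard group on `UZ(B)` -/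

namespace MoritaBimodule

variable {B : Type u} [CStarAlgebra B]

lemma l_injective (M : MoritaBimodule.{u, w} B) {a b : B} (h : ∀ m, M.l a m = M.l b m) :
    a = b := by
  obtain ⟨ι, _, x, hx⟩ := M.exists_frame
  rw [← mul_one a, ← mul_one b, ← hx, Finset.mul_sum, Finset.mul_sum]
  exact Finset.sum_congr rfl fun i _ => by rw [← M.linner_l_left, h, M.linner_l_left]

lemma exists_twist (M : MoritaBimodule.{u, w} B) (z : UZ B) :
    ∃ v : UZ B, ∀ m, M.l (v.1 : B) m = M.r m (z.1 : B) := by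
  obtain ⟨ι, _, x, hx⟩ := M.exists_frame
  set v : B := ∑ i, M.linner (M.r (x i) (z.1 : B)) (x i) with hv
  have hz : ∀ b : B, (z.1 : B) * b = b * z.1 := z.2
  have h1 : ∀ m, M.l v m = M.r m (z.1 : B) := fun m => by
    rw [hv, M.sum_l]
    simp_rw [M.linner_l_eq, ← M.r_mul, hz, M.r_mul]
    rw [← M.sum_r, frame_sum hx]
  have h2 : ∀ m, M.l (star v) m = M.r m (star (z.1 : B)) := fun m => M.ext_rinner fun y => by
    rw [M.rinner_l_right, star_star, h1, M.rinner_r_left, M.rinner_r_right]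
    have := congrArg star (hz (star (M.rinner y m)))
    simpa using this.symm
  have h3 : star v * v = 1 := M.l_injective fun m => by
    rw [M.mul_l, h1, h2, ← M.r_mul, Unitary.mul_star_self_of_mem z.1.2, M.r_one, M.one_l]
  have h4 : v * star v = 1 := M.l_injective fun m => by
    rw [M.mul_l, h2, h1, ← M.r_mul, Unitary.star_mul_self_of_mem z.1.2, M.r_one, M.one_l]
  refine ⟨⟨⟨v, h3, h4⟩, fun b => M.l_injective fun m => ?_⟩, h1⟩
  change M.l (v * b) m = M.l (b * v) m
  rw [M.mul_l, M.mul_l, h1, h1, M.l_r]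

/-- The element `ψ_M(z)` of `UZ(B)` with `ψ_M(z) m = m z` for all `m ∈ M`. -/
noncomputable def twist (M : MoritaBimodule.{u, w} B) (z : UZ B) : UZ B :=
  (M.exists_twist z).choose

lemma twist_l (M : MoritaBimodule.{u, w} B) (z : UZ B) (m : M) :
    M.l ((M.twist z).1 : B) m = M.r m (z.1 : B) := (M.exists_twist z).choose_spec m

lemma eq_twist (M : MoritaBimodule.{u, w} B) {z v : UZ B}
    (h : ∀ m, M.l (v.1 : B) m = M.r m (z.1 : B)) : v = M.twist z :=
  Subtype.ext (Subtype.ext (M.l_injective fun m => by rw [h, M.twist_l]))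

lemma dual_twist (M : MoritaBimodule.{u, w} B) (z : UZ B) (m : M) :
    M.r m ((M.dual.twist z).1 : B) = M.l (z.1 : B) m := by
  have h : ∀ y, M.r y (star ((M.dual.twist z).1 : B)) = M.l (star (z.1 : B)) y :=
    M.dual.twist_l z
  have hz : ∀ b : B, (z.1 : B) * b = b * z.1 := z.2
  refine M.ext_linner fun y => ?_
  rw [M.linner_r_left, h, M.linner_l_right, star_star, M.linner_l_left, hz]

lemma r_injective (M : MoritaBimodule.{u, w} B) {a b : B} (h : ∀ m, M.r m a = M.r m b) :
    a = b := by
  refine star_injective (M.dual.l_injective fun m => ?_)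
  change M.r m (star (star a)) = M.r m (star (star b))
  rw [star_star, star_star]
  exact h m

/-- The automorphism `ψ_M` of `UZ(B)`. -/
noncomputable def twistAut (M : MoritaBimodule.{u, w} B) : MulAut (UZ B) where
  toFun := M.twist
  invFun := M.dual.twist
  left_inv z := Subtype.ext (Subtype.ext (M.r_injective fun m => by
    rw [M.dual_twist, M.twist_l]))
  right_inv z := (M.eq_twist fun m => (M.dual_twist z m).symm).symm
  map_mul' z z' := (M.eq_twist fun m => by
    have h : ((M.twist z * M.twist z').1 : B) = (M.twist z).1 * (M.twist z').1 := rfl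
    have h' : ((z * z').1 : B) = (z'.1 : B) * z.1 := by rw [mul_comm z z']; rfl
    rw [h, h', M.mul_l, M.twist_l, M.r_mul, M.twist_l]).symm

@[simp] lemma twistAut_apply (M : MoritaBimodule.{u, w} B) (z : UZ B) :
    M.twistAut z = M.twist z := rfl

end MoritaBimodule

/-- The homomorphism `μ : Pic(B) → Aut(UZ(B))`, `[M] ↦ ψ_M`. -/
noncomputable def Pic.toAut (B : Type u) [CStarAlgebra B] : Pic B →* MulAut (UZ B) :=
  MonoidHom.mk' (Quotient.lift twistAut fun M N ⟨f⟩ => MulEquiv.ext fun z =>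
    N.eq_twist fun n => by
      obtain ⟨m, rfl⟩ := f.toEquiv.surjective n
      rw [← f.map_l, ← f.map_r, twistAut_apply, M.twist_l]) (by
    rintro ⟨M⟩ ⟨N⟩
    refine MulEquiv.ext fun z => ((tensor M N).eq_twist fun p => ?_).symm
    change (tensor M N).l ((M.twist (N.twist z)).1 : B) p = _
    have hp : p ∈ AddSubgroup.closure
        (Set.range fun p : M × N => (tensorMap M N).toFun p.1 p.2) := by
      rw [(tensorMap M N).closure_eq_top]; trivial
    change (tensor M N).lHom _ p = (tensor M N).rHom _ p
    induction hp using AddSubgroup.closure_induction with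
    | mem p hp =>
      obtain ⟨⟨m, n⟩, rfl⟩ := hp
      change (tensor M N).l _ _ = (tensor M N).r _ _
      rw [← (tensorMap M N).map_l, M.twist_l, (tensorMap M N).balanced, N.twist_l,
        (tensorMap M N).map_r]
    | zero => rw [map_zero, map_zero]
    | add x y _ _ hx hy => rw [map_add, map_add, hx, hy]
    | neg x _ hx => rw [map_neg, map_neg, hx])

lemma Pic.toAut_mk {B : Type u} [CStarAlgebra B] (M : MoritaBimodule.{u, u} B) :
    Pic.toAut B (Pic.mk M) = M.twistAut := rfl

/-- `H ^ p (G, UZ(B))_ψ`, for the `G`-module structure on `UZ(B)` induced by `ψ`. -/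
abbrev PicCohomology {G : Type v} [Group G] {B : Type u} [CStarAlgebra B] (ψ : G →* Pic B)
    (p : ℕ) : Type (max u v) :=
  Cohomology ((Pic.toAut B).comp ψ) p

/-! ## Fell bundles over discrete groups -/

/-- A set `carrier` with a map `π` to the group `G`, an associative multiplication and an
involution with `(s t)⋆ = t⋆ s⋆` and `s⋆⋆ = s`, both compatible with `π`. -/
structure GradedStarSemigroup (G : Type v) [Group G] where
  carrier : Type w
  [semigroup : Semigroup carrier]
  [starMul : StarMul carrier]
  π : carrier → G
  π_mul : ∀ s t, π (s * t) = π s * π t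
  π_star : ∀ s, π (star s) = (π s)⁻¹

namespace GradedStarSemigroup

variable {G : Type v} [Group G] (𝓑 : GradedStarSemigroup.{v, w} G)

instance : Semigroup 𝓑.carrier := 𝓑.semigroup
instance : StarMul 𝓑.carrier := 𝓑.starMul

/-- The fiber over `g`. -/
def Fiber (g : G) : Type w := {s : 𝓑.carrier // 𝓑.π s = g}

variable {𝓑}

/-- The multiplication as a map `B_g × B_h → B_{gh}`. -/
def fmul {g h : G} (s : 𝓑.Fiber g) (t : 𝓑.Fiber h) : 𝓑.Fiber (g * h) :=
  ⟨s.1 * t.1, by rw [𝓑.π_mul, s.2, t.2]⟩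

/-- The involution as a map `B_g → B_{g⁻¹}`. -/
def fstar {g : G} (s : 𝓑.Fiber g) : 𝓑.Fiber g⁻¹ :=
  ⟨star s.1, by rw [𝓑.π_star, s.2]⟩

end GradedStarSemigroup

open GradedStarSemigroup

/-- A Fell bundle over the discrete group `G`. The topology of the total space is not part of the
data: since `G` is discrete, it has to be the disjoint union topology of the norm topologies of the
fibers, and then multiplication and involution are automatically continuous. An element of the unit
fiber is positive if it is of the form `t⋆ t` with `t` in the unit fiber. -/
structure FellBundle (G : Type v) [Group G] extends GradedStarSemigroup.{v, w} G where
  [normedAddCommGroup : ∀ g, NormedAddCommGroup (toGradedStarSemigroup.Fiber g)]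
  [normedSpace : ∀ g, NormedSpace ℂ (toGradedStarSemigroup.Fiber g)]
  [completeSpace : ∀ g, CompleteSpace (toGradedStarSemigroup.Fiber g)]
  add_fmul : ∀ {g h : G} (s s' : toGradedStarSemigroup.Fiber g)
    (t : toGradedStarSemigroup.Fiber h), fmul (s + s') t = fmul s t + fmul s' t
  fmul_add : ∀ {g h : G} (s : toGradedStarSemigroup.Fiber g)
    (t t' : toGradedStarSemigroup.Fiber h), fmul s (t + t') = fmul s t + fmul s t'
  smul_fmul : ∀ {g h : G} (z : ℂ) (s : toGradedStarSemigroup.Fiber g)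
    (t : toGradedStarSemigroup.Fiber h), fmul (z • s) t = z • fmul s t
  fmul_smul : ∀ {g h : G} (z : ℂ) (s : toGradedStarSemigroup.Fiber g)
    (t : toGradedStarSemigroup.Fiber h), fmul s (z • t) = z • fmul s t
  norm_fmul_le : ∀ {g h : G} (s : toGradedStarSemigroup.Fiber g)
    (t : toGradedStarSemigroup.Fiber h), ‖fmul s t‖ ≤ ‖s‖ * ‖t‖
  fstar_add : ∀ {g : G} (s t : toGradedStarSemigroup.Fiber g), fstar (s + t) = fstar s + fstar t
  fstar_smul : ∀ {g : G} (z : ℂ) (s : toGradedStarSemigroup.Fiber g),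
    fstar (z • s) = star z • fstar s
  norm_fstar_fmul_self : ∀ {g : G} (s : toGradedStarSemigroup.Fiber g),
    ‖fmul (fstar s) s‖ = ‖s‖ ^ 2
  star_mul_self_nonneg : ∀ s : carrier,
    ∃ t : toGradedStarSemigroup.Fiber 1, star s * s = star t.1 * t.1

/-- A saturated Fell bundle over the discrete group `G` with unit fiber `B`: the linear span of
`B_g B_h` is dense in `B_{gh}`, and the unit fiber is identified, as a C⋆-algebra, with `B` through
`unit`. -/
structure SaturatedFellBundle (G : Type v) [Group G] (B : Type u) [CStarAlgebra B] extends
    FellBundle.{v, w} G where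
  saturated : ∀ g h : G, Dense (Submodule.span ℂ (Set.range
    fun p : toGradedStarSemigroup.Fiber g × toGradedStarSemigroup.Fiber h => fmul p.1 p.2) :
      Set (toGradedStarSemigroup.Fiber (g * h)))
  unit : B ≃ₗᵢ[ℂ] toGradedStarSemigroup.Fiber 1
  unit_mul : ∀ a b, (unit (a * b)).1 = (unit a).1 * (unit b).1
  unit_star : ∀ a, (unit (star a)).1 = star (unit a).1

namespace FellBundle

variable {G : Type v} [Group G] (𝓑 : FellBundle.{v, w} G)

/-- The fiber over `g`. -/
abbrev Fib (g : G) : Type w := 𝓑.toGradedStarSemigroup.Fiber g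

instance (g : G) : NormedAddCommGroup (𝓑.toGradedStarSemigroup.Fiber g) := 𝓑.normedAddCommGroup g
instance (g : G) : NormedSpace ℂ (𝓑.toGradedStarSemigroup.Fiber g) := 𝓑.normedSpace g
instance (g : G) : CompleteSpace (𝓑.toGradedStarSemigroup.Fiber g) := 𝓑.completeSpace g

/-- The identification of the fibers over equal elements. -/
def castF {g h : G} (e : g = h) : 𝓑.Fib g ≃ₗᵢ[ℂ] 𝓑.Fib h where
  toFun s := ⟨s.1, s.2.trans e⟩
  invFun s := ⟨s.1, s.2.trans e.symm⟩
  left_inv _ := rfl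
  right_inv _ := rfl
  map_add' _ _ := by subst e; rfl
  map_smul' _ _ := by subst e; rfl
  norm_map' _ := by subst e; rfl

variable {𝓑}

lemma castF_val {g h : G} (e : g = h) (s : 𝓑.Fib g) : (𝓑.castF e s).1 = s.1 := rfl

lemma fib_ext {g : G} {s t : 𝓑.Fib g} (h : s.1 = t.1) : s = t := Subtype.ext h

lemma norm_eq_of_val {g h : G} (e : g = h) (s : 𝓑.Fib g) (t : 𝓑.Fib h) (hst : s.1 = t.1) :
    ‖s‖ = ‖t‖ := by
  subst e; rw [fib_ext hst]

lemma norm_fstar {g : G} (s : 𝓑.Fib g) : ‖fstar s‖ = ‖s‖ := by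
  have key : ∀ {g : G} (s : 𝓑.Fib g), ‖s‖ ≤ ‖fstar s‖ := fun {g} s => by
    have h := 𝓑.norm_fmul_le (fstar s) s
    rw [𝓑.norm_fstar_fmul_self, sq] at h
    by_contra! hlt
    have h0 : 0 < ‖s‖ := (norm_nonneg _).trans_lt hlt
    nlinarith
  refine le_antisymm ((key (fstar s)).trans_eq ?_) (key s)
  exact norm_eq_of_val (inv_inv g) _ _ (star_star s.1)

lemma norm_fmul_fstar_self {g : G} (s : 𝓑.Fib g) : ‖fmul s (fstar s)‖ = ‖s‖ ^ 2 := by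
  rw [← norm_fstar s, ← 𝓑.norm_fstar_fmul_self (fstar s)]
  refine norm_eq_of_val (by rw [inv_inv]) _ _ ?_
  change s.1 * star s.1 = star (star s.1) * star s.1
  rw [star_star]

end FellBundle

namespace SaturatedFellBundle

variable {G : Type v} [Group G] {B : Type u} [CStarAlgebra B]
  (𝓑 : SaturatedFellBundle.{u, v, w} G B)

/-- The fiber over `g`. -/
abbrev Fib (g : G) : Type w := 𝓑.toFellBundle.Fib g

variable {𝓑} {g : G}

/-- The left action of `B` on the fiber over `g`. -/
noncomputable def lact (b : B) (s : 𝓑.Fib g) : 𝓑.Fib g :=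
  𝓑.castF (one_mul g) (fmul (𝓑.unit b) s)

/-- The right action of `B` on the fiber over `g`. -/
noncomputable def ract (s : 𝓑.Fib g) (b : B) : 𝓑.Fib g :=
  𝓑.castF (mul_one g) (fmul s (𝓑.unit b))

/-- The left inner product `s t⋆` on the fiber over `g`. -/
noncomputable def linn (s t : 𝓑.Fib g) : B :=
  𝓑.unit.symm (𝓑.castF (mul_inv_cancel g) (fmul s (fstar t)))

/-- The right inner product `s⋆ t` on the fiber over `g`. -/
noncomputable def rinn (s t : 𝓑.Fib g) : B :=
  𝓑.unit.symm (𝓑.castF (inv_mul_cancel g) (fmul (fstar s) t))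

lemma lact_val (b : B) (s : 𝓑.Fib g) : (lact b s).1 = (𝓑.unit b).1 * s.1 := rfl
lemma ract_val (s : 𝓑.Fib g) (b : B) : (ract s b).1 = s.1 * (𝓑.unit b).1 := rfl

lemma unit_linn (s t : 𝓑.Fib g) : (𝓑.unit (linn s t)).1 = s.1 * star t.1 := by
  rw [linn, LinearIsometryEquiv.apply_symm_apply]; rfl

lemma unit_rinn (s t : 𝓑.Fib g) : (𝓑.unit (rinn s t)).1 = star s.1 * t.1 := by
  rw [rinn, LinearIsometryEquiv.apply_symm_apply]; rfl

lemma ext_unit {a b : B} (h : (𝓑.unit a).1 = (𝓑.unit b).1) : a = b :=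
  𝓑.unit.injective (Subtype.ext h)

lemma linn_add_left (s s' t : 𝓑.Fib g) : linn (s + s') t = linn s t + linn s' t := by
  simp only [linn, 𝓑.add_fmul, map_add]

lemma rinn_add_right (s t t' : 𝓑.Fib g) : rinn s (t + t') = rinn s t + rinn s t' := by
  simp only [rinn, 𝓑.fmul_add, map_add]

lemma star_linn (s t : 𝓑.Fib g) : star (linn s t) = linn t s :=
  ext_unit (𝓑 := 𝓑) (by rw [𝓑.unit_star, unit_linn, unit_linn, star_mul, star_star])

lemma star_rinn (s t : 𝓑.Fib g) : star (rinn s t) = rinn t s :=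
  ext_unit (𝓑 := 𝓑) (by rw [𝓑.unit_star, unit_rinn, unit_rinn, star_mul, star_star])

lemma linn_lact (a : B) (s t : 𝓑.Fib g) : linn (lact a s) t = a * linn s t :=
  ext_unit (𝓑 := 𝓑) (by rw [𝓑.unit_mul, unit_linn, unit_linn, lact_val, mul_assoc])

lemma rinn_ract (s t : 𝓑.Fib g) (b : B) : rinn s (ract t b) = rinn s t * b :=
  ext_unit (𝓑 := 𝓑) (by rw [𝓑.unit_mul, unit_rinn, unit_rinn, ract_val, mul_assoc])

lemma norm_linn (s : 𝓑.Fib g) : ‖s‖ ^ 2 = ‖linn s s‖ := by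
  rw [linn, LinearIsometryEquiv.norm_map, LinearIsometryEquiv.norm_map,
    FellBundle.norm_fmul_fstar_self]

lemma norm_rinn (s : 𝓑.Fib g) : ‖s‖ ^ 2 = ‖rinn s s‖ := by
  rw [rinn, LinearIsometryEquiv.norm_map, LinearIsometryEquiv.norm_map,
    𝓑.norm_fstar_fmul_self]

lemma eq_of_linn {s t : 𝓑.Fib g} (h : ∀ y, linn s y = linn t y) : s = t := by
  have h1 := norm_linn (s - t)
  have h2 : linn (s - t) (s - t) = 0 := by
    have := linn_add_left (s - t) t (s - t)
    rw [sub_add_cancel, h] at this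
    exact right_eq_add.1 this
  rw [h2, norm_zero] at h1
  exact sub_eq_zero.1 (norm_eq_zero.1 (pow_eq_zero_iff two_ne_zero |>.1 h1))

lemma eq_of_rinn {s t : 𝓑.Fib g} (h : ∀ y, rinn y s = rinn y t) : s = t := by
  have h1 := norm_rinn (s - t)
  have h2 : rinn (s - t) (s - t) = 0 := by
    have := rinn_add_right (s - t) (s - t) t
    rw [sub_add_cancel, h] at this
    exact right_eq_add.1 this
  rw [h2, norm_zero] at h1
  exact sub_eq_zero.1 (norm_eq_zero.1 (pow_eq_zero_iff two_ne_zero |>.1 h1))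

variable (𝓑)

lemma linn_full (g : G) : Dense (Submodule.span ℂ (Set.range fun p : 𝓑.Fib g × 𝓑.Fib g =>
    linn p.1 p.2) : Set B) := by
  let φ : 𝓑.Fib (g * g⁻¹) ≃ₗᵢ[ℂ] B := (𝓑.castF (mul_inv_cancel g)).trans 𝓑.unit.symm
  refine (φ.surjective.denseRange.dense_image φ.continuous (𝓑.saturated g g⁻¹)).mono ?_
  rintro _ ⟨s, hs, rfl⟩
  have h := Submodule.mem_map_of_mem (f := (φ.toLinearEquiv : 𝓑.Fib (g * g⁻¹) →ₗ[ℂ] B)) hs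
  rw [Submodule.map_span] at h
  refine Submodule.span_mono ?_ h
  rintro _ ⟨_, ⟨⟨s, t⟩, rfl⟩, rfl⟩
  refine ⟨(s, 𝓑.castF (inv_inv g) (fstar t)), ext_unit (𝓑 := 𝓑) ?_⟩
  change (𝓑.unit (linn s _)).1 = (𝓑.unit (𝓑.unit.symm _)).1
  rw [unit_linn, LinearIsometryEquiv.apply_symm_apply]
  change s.1 * star (star t.1) = s.1 * t.1
  rw [star_star]

lemma rinn_full (g : G) : Dense (Submodule.span ℂ (Set.range fun p : 𝓑.Fib g × 𝓑.Fib g =>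
    rinn p.1 p.2) : Set B) := by
  let φ : 𝓑.Fib (g⁻¹ * g) ≃ₗᵢ[ℂ] B := (𝓑.castF (inv_mul_cancel g)).trans 𝓑.unit.symm
  refine (φ.surjective.denseRange.dense_image φ.continuous (𝓑.saturated g⁻¹ g)).mono ?_
  rintro _ ⟨s, hs, rfl⟩
  have h := Submodule.mem_map_of_mem (f := (φ.toLinearEquiv : 𝓑.Fib (g⁻¹ * g) →ₗ[ℂ] B)) hs
  rw [Submodule.map_span] at h
  refine Submodule.span_mono ?_ h
  rintro _ ⟨_, ⟨⟨s, t⟩, rfl⟩, rfl⟩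
  refine ⟨(𝓑.castF (inv_inv g) (fstar s), t), ext_unit (𝓑 := 𝓑) ?_⟩
  change (𝓑.unit (rinn _ t)).1 = (𝓑.unit (𝓑.unit.symm _)).1
  rw [unit_rinn, LinearIsometryEquiv.apply_symm_apply]
  change star (star s.1) * t.1 = s.1 * t.1
  rw [star_star]

/-- The fiber `B_g` of a saturated Fell bundle with unit fiber `B` as a Morita equivalence
`B`-bimodule: the actions are given by multiplication, the inner products by
`ₗ⟨s, t⟩ = s t⋆` and `⟨s, t⟩ᵣ = s⋆ t`. -/
noncomputable def fiberBimodule (g : G) : MoritaBimodule.{u, w} B where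
  carrier := 𝓑.Fib g
  l := lact
  r := ract
  l_add a x y := by simp only [lact, 𝓑.fmul_add, map_add]
  add_l a b x := by simp only [lact, 𝓑.add_fmul, map_add]
  l_smul a z x := by simp only [lact, 𝓑.fmul_smul, map_smul]
  smul_l a z x := by simp only [lact, 𝓑.smul_fmul, map_smul]
  mul_l a b x := Subtype.ext (by rw [lact_val, lact_val, lact_val, 𝓑.unit_mul, mul_assoc])
  one_l x := eq_of_linn fun y => by rw [linn_lact, one_mul]
  add_r x y b := by simp only [ract, 𝓑.add_fmul, map_add]
  r_add x a b := by simp only [ract, 𝓑.fmul_add, map_add]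
  smul_r z x b := by simp only [ract, 𝓑.smul_fmul, map_smul]
  r_smul z x b := by simp only [ract, 𝓑.fmul_smul, map_smul]
  r_mul x a b := Subtype.ext (by rw [ract_val, ract_val, ract_val, 𝓑.unit_mul, mul_assoc])
  r_one x := eq_of_rinn fun y => by rw [rinn_ract, mul_one]
  l_r a x b := Subtype.ext (by rw [lact_val, ract_val, ract_val, lact_val, mul_assoc])
  linner := linn
  rinner := rinn
  linner_add_left := linn_add_left
  linner_l_left := linn_lact
  star_linner := star_linn
  linner_self_nonneg s := by
    obtain ⟨t, ht⟩ := 𝓑.star_mul_self_nonneg (star s.1)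
    obtain ⟨b, rfl⟩ := 𝓑.unit.surjective t
    refine ⟨b, ext_unit (𝓑 := 𝓑) ?_⟩
    rw [unit_linn, 𝓑.unit_mul, 𝓑.unit_star, ← ht, star_star]
  norm_sq_eq_linner := norm_linn
  linner_full := 𝓑.linn_full g
  rinner_add_right := rinn_add_right
  rinner_r_right := rinn_ract
  star_rinner := star_rinn
  rinner_self_nonneg s := by
    obtain ⟨t, ht⟩ := 𝓑.star_mul_self_nonneg s.1
    obtain ⟨b, rfl⟩ := 𝓑.unit.surjective t
    refine ⟨b, ext_unit (𝓑 := 𝓑) ?_⟩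
    rw [unit_rinn, 𝓑.unit_mul, 𝓑.unit_star, ← ht]
  norm_sq_eq_rinner := norm_rinn
  rinner_full := 𝓑.rinn_full g
  rinner_l_left a s t := ext_unit (𝓑 := 𝓑) (by
    rw [unit_rinn, unit_rinn, lact_val, lact_val, star_mul, 𝓑.unit_star, mul_assoc])
  linner_r_left s b t := ext_unit (𝓑 := 𝓑) (by
    rw [unit_linn, unit_linn, ract_val, ract_val, star_mul, 𝓑.unit_star, star_star, mul_assoc])
  linner_l_eq s t y := Subtype.ext (by
    rw [lact_val, ract_val, unit_linn, unit_rinn, mul_assoc])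

/-- An equivalence of saturated Fell bundles with unit fiber `B`: a family of linear isometric
bijections between the fibers that is the identity on the unit fiber `B` and preserves
multiplication and involution. -/
structure Equivalence (𝓑 𝓑' : SaturatedFellBundle.{u, v, w} G B) where
  toIso : ∀ g, 𝓑.Fib g ≃ₗᵢ[ℂ] 𝓑'.Fib g
  map_unit : ∀ b, toIso 1 (𝓑.unit b) = 𝓑'.unit b
  map_fmul : ∀ {g h : G} (s : 𝓑.Fib g) (t : 𝓑.Fib h),
    toIso (g * h) (fmul s t) = fmul (toIso g s) (toIso h t)
  map_fstar : ∀ {g : G} (s : 𝓑.Fib g), toIso g⁻¹ (fstar s) = fstar (toIso g s)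

instance setoid (G : Type v) [Group G] (B : Type u) [CStarAlgebra B] :
    Setoid (SaturatedFellBundle.{u, v, w} G B) where
  r 𝓑 𝓑' := Nonempty (Equivalence 𝓑 𝓑')
  iseqv :=
    { refl := fun 𝓑 => ⟨⟨fun _ => LinearIsometryEquiv.refl ℂ _, fun _ => rfl, fun _ _ => rfl,
        fun _ => rfl⟩⟩
      symm := fun {𝓑 𝓑'} ⟨f⟩ => ⟨⟨fun g => (f.toIso g).symm,
        fun b => by rw [LinearIsometryEquiv.symm_apply_eq, f.map_unit],
        fun s t => by
          rw [LinearIsometryEquiv.symm_apply_eq, f.map_fmul,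
            LinearIsometryEquiv.apply_symm_apply, LinearIsometryEquiv.apply_symm_apply],
        fun s => by
          rw [LinearIsometryEquiv.symm_apply_eq, f.map_fstar,
            LinearIsometryEquiv.apply_symm_apply]⟩⟩
      trans := fun ⟨f⟩ ⟨f'⟩ => ⟨⟨fun g => (f.toIso g).trans (f'.toIso g),
        fun b => by rw [LinearIsometryEquiv.trans_apply, f.map_unit, f'.map_unit],
        fun s t => by simp only [LinearIsometryEquiv.trans_apply, f.map_fmul, f'.map_fmul],
        fun s => by simp only [LinearIsometryEquiv.trans_apply, f.map_fstar, f'.map_fstar]⟩⟩ }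

/-- The Picard homomorphism `g ↦ [B_g]` of the bundle is `ψ`: every fiber `B_g` is a representative
of the class `ψ g`. (The fibers may live in a larger universe than `B`, hence the isomorphism.) -/
def HasPicard (ψ : G →* Pic B) : Prop :=
  ∀ g, ∃ M : MoritaBimodule.{u, u} B, Pic.mk M = ψ g ∧ Nonempty (Iso M (𝓑.fiberBimodule g))

end SaturatedFellBundle

/-- `Ext(G, B)`: equivalence classes of saturated Fell bundles over `G` with unit fiber `B`. -/
def Ext (G : Type v) [Group G] (B : Type u) [CStarAlgebra B] : Type (max u v + 1) :=
  Quotient (SaturatedFellBundle.setoid.{u, v, max u v} G B)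

/-- `Ext(G, B, ψ)`: the classes of those bundles whose Picard homomorphism is `ψ`. -/
def ExtOver {G : Type v} [Group G] {B : Type u} [CStarAlgebra B] (ψ : G →* Pic B) :
    Set (Ext G B) :=
  {x | ∃ 𝓑 : SaturatedFellBundle.{u, v, max u v} G B, Quotient.mk _ 𝓑 = x ∧ 𝓑.HasPicard ψ}

/-! ## Choices of representatives and their associativity defect -/

/-- A choice of representatives `X g` of `ψ g`, with an identification `ι` of `X 1` with `B`, and of
isomorphisms `Ψ g h : X g ⊗ X h → X (g h)`, normalized in that `Ψ 1 g` and `Ψ g 1` are the left and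
the right action of `B` on `X g` (so `Ψ 1 1` is the multiplication of `B`). Equalities between
elements of `X (1 * g)` and `X g` are expressed in the disjoint union of the `X g`. -/
structure Choice {G : Type v} [Group G] {B : Type u} [CStarAlgebra B] (ψ : G →* Pic B) where
  X : G → MoritaBimodule.{u, u} B
  mk_X : ∀ g, Pic.mk (X g) = ψ g
  ι : Iso (MoritaBimodule.self B) (X 1)
  Ψ : ∀ g h, Iso (tensor (X g) (X h)) (X (g * h))
  Ψ_one_left : ∀ (g : G) (b : B) (x : X g),
    (⟨1 * g, Ψ 1 g (tmul (ι b) x)⟩ : Σ g, X g) = ⟨g, (X g).l b x⟩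
  Ψ_one_right : ∀ (g : G) (x : X g) (b : B),
    (⟨g * 1, Ψ g 1 (tmul x (ι b))⟩ : Σ g, X g) = ⟨g, (X g).r x b⟩

/-- `ω` is the associativity defect of the choice `L`:
`Ψ_{gh,k} ∘ (Ψ_{g,h} ⊗ id) = ω(g, h, k) · Ψ_{g,hk} ∘ (id ⊗ Ψ_{h,k})`, that is, the automorphism
`Ψ_{gh,k} ∘ (Ψ_{g,h} ⊗ id) ∘ (id ⊗ Ψ_{h,k})⁻¹ ∘ Ψ_{g,hk}⁻¹` of `X (g h k)` is the left
multiplication by `ω(g, h, k)`. -/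
def Choice.IsDefect {G : Type v} [Group G] {B : Type u} [CStarAlgebra B] {ψ : G →* Pic B}
    (L : Choice ψ) (ω : (Fin 3 → G) → UZ B) : Prop :=
  ∀ (g h k : G) (x : L.X g) (y : L.X h) (z : L.X k),
    (⟨g * h * k, L.Ψ (g * h) k (tmul (L.Ψ g h (tmul x y)) z)⟩ : Σ g, L.X g) =
      ⟨g * (h * k), (L.X (g * (h * k))).l ((ω ![g, h, k]).1 : B)
        (L.Ψ g (h * k) (tmul x (L.Ψ h k (tmul y z))))⟩

end FellExt

/-!
# The obstruction to the existence of saturated Fell bundles with given Picard homomorphism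

A Morita equivalence bimodule over the unital algebra `B` has finite frames, `∑ ₗ⟨xᵢ, xᵢ⟩ = 1`. Two
consequences carry the whole argument. Tensor products are generated algebraically by elementary
tensors, so two families of generators with equal Gram matrices are related by a unique isomorphism
(`exists_iso_of_closure`); and the automorphisms of a bimodule are exactly the left multiplications
by elements of `UZ(B)` (`Iso.exists_eq_l`).

A choice for `ψ` turns the disjoint union of the `X g` into a graded set with a multiplication
(`Choice.Total`) on which `UZ(B)` acts, `s (z t) = ψ_g(z) (s t)` for `s` of degree `g`. The two ways
of bracketing a triple product differ by an automorphism, hence by a unique `ω(g, h, k) ∈ UZ(B)`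
(`Choice.exists_isDefect`). Rebracketing a product of four factors in two ways gives the cocycle
identity (`IsDefect.mem_cocycles`). Isomorphisms between the bimodules of two choices are
multiplicative up to a `2`-cochain `ρ`, and the two defects differ by the differential of `ρ`
(`Choice.exists_comparison`, `IsDefect.eq_mul_differential`); conversely, twisting a choice by `ρ`
removes the coboundary of `ρ` from its defect (`IsDefect.exists_isDefect_one`).

The multiplication of a saturated Fell bundle is associative, so its fibers form a choice with
trivial defect (`HasPicard.exists_isDefect_one`). Conversely a choice with trivial defect is a
saturated Fell bundle once an involution is found. Since `X g⁻¹` is inverse to `X g`, it is dual to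
`X g`, which provides for `x ∈ X g` a unique `x⋆ ∈ X g⁻¹` with `x⋆ y = ⟨x, y⟩ᵣ` for all `y ∈ X g`
(`TensorMap.exists_adjoint`). All properties of the involution follow from this formula and
associativity.
-/

namespace FellExt

open MoritaBimodule GradedStarSemigroup

/-! ### Isomorphisms and tensor maps of Morita equivalence bimodules -/

namespace MoritaBimodule

variable {B : Type u} [CStarAlgebra B]

namespace Iso

variable {M : MoritaBimodule.{u, w} B} {N : MoritaBimodule.{u, w'} B} (f : Iso M N)

lemma map_smul (z : ℂ) (x : M) : f (z • x) = z • f x := by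
  rw [← M.l_smul_eq, f.map_l, N.l_smul_eq]

lemma norm_map (x : M) : ‖f x‖ = ‖x‖ := by
  rw [← sq_eq_sq₀ (norm_nonneg _) (norm_nonneg _), N.norm_sq_eq_linner, f.linner_map,
    M.norm_sq_eq_linner]

/-- An isomorphism of bimodules as an isometry of the underlying Banach spaces. -/
def toLinearIsometryEquiv : M ≃ₗᵢ[ℂ] N where
  toEquiv := f.toEquiv
  map_add' := f.map_add
  map_smul' := f.map_smul
  norm_map' := f.norm_map

/-- The automorphisms of a Morita equivalence bimodule are the left multiplications by unitary
central elements. The witness is `∑ ₗ⟨f(xᵢ), xᵢ⟩` for a frame `x`. -/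
lemma exists_eq_l {M : MoritaBimodule.{u, w} B} (f : Iso M M) :
    ∃ z : UZ B, ∀ x, f x = M.l (z.1 : B) x := by
  obtain ⟨ι, _, x, hx⟩ := M.exists_frame
  set v : B := ∑ i, M.linner (f (x i)) (x i) with hv
  have h1 : ∀ m, M.l v m = f m := fun m => by
    rw [hv, M.sum_l]
    simp_rw [M.linner_l_eq, ← f.map_r]
    nth_rewrite 2 [← frame_sum hx m]
    exact (map_sum (AddMonoidHom.mk' f.toEquiv f.map_add) _ _).symm
  have h2 : ∀ b : B, v * b = b * v := fun b => M.l_injective fun m => by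
    rw [M.mul_l, M.mul_l, h1, h1, f.map_l]
  have h3 : star v * v = 1 := M.l_injective fun m => M.ext_rinner fun y => by
    rw [M.mul_l, M.rinner_l_right, star_star, h1, h1, f.rinner_map, M.one_l]
  exact ⟨⟨⟨v, h3, by rw [h2, h3]⟩, h2⟩, fun m => (h1 m).symm⟩

end Iso

/-- Left multiplication by a unitary central element, as an automorphism. -/
def lIso (M : MoritaBimodule.{u, w} B) (z : UZ B) : Iso M M where
  toEquiv :=
    { toFun := M.l (z.1 : B)
      invFun := M.l (star (z.1 : B))
      left_inv := fun x => by rw [← M.mul_l, Unitary.star_mul_self_of_mem z.1.2, M.one_l]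
      right_inv := fun x => by rw [← M.mul_l, Unitary.mul_star_self_of_mem z.1.2, M.one_l] }
  map_add := M.l_add _
  map_l b x := by
    have hz : ∀ b : B, (z.1 : B) * b = b * z.1 := z.2
    change M.l _ (M.l _ _) = M.l _ (M.l _ _)
    rw [← M.mul_l, hz, M.mul_l]
  map_r x b := (M.l_r _ x b).symm
  linner_map x y := by
    have hz : ∀ b : B, (z.1 : B) * b = b * z.1 := z.2
    change M.linner (M.l _ _) (M.l _ _) = _
    rw [M.linner_l_left, M.linner_l_right, ← mul_assoc, hz, mul_assoc,
      Unitary.mul_star_self_of_mem z.1.2, mul_one]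
  rinner_map x y := by
    change M.rinner (M.l _ _) (M.l _ _) = _
    rw [M.rinner_l_left, ← M.mul_l, Unitary.star_mul_self_of_mem z.1.2, M.one_l]

/-- The members of a family at equal indices are isomorphic by the identification of the two
fibers of the disjoint union of the family. -/
lemma exists_iso_of_eq {G : Type v} (X : G → MoritaBimodule.{u, w} B) {g h : G} (e : g = h) :
    ∃ f : Iso (X g) (X h), ∀ x, (⟨h, f x⟩ : Σ g, X g) = ⟨g, x⟩ := by
  subst e
  exact ⟨Iso.refl _, fun _ => rfl⟩

/-- Two generating families with the same left and right Gram matrices correspond to each other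
under an isomorphism. -/
lemma exists_iso_of_closure {I : Type*} {P P' : MoritaBimodule.{u, w} B}
    (β : I → P) (β' : I → P')
    (hβ : AddSubgroup.closure (Set.range β) = ⊤) (hβ' : AddSubgroup.closure (Set.range β') = ⊤)
    (hl : ∀ i j, P'.linner (β' i) (β' j) = P.linner (β i) (β j))
    (hr : ∀ i j, P'.rinner (β' i) (β' j) = P.rinner (β i) (β j)) :
    ∃ f : Iso P P', ∀ i, f (β i) = β' i := by
  have surj : ∀ {Q : MoritaBimodule.{u, w} B} (γ : I → Q),
      AddSubgroup.closure (Set.range γ) = ⊤ →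
      Function.Surjective (FreeAbelianGroup.lift γ) := by
    intro Q γ h
    rw [← AddMonoidHom.range_eq_top, ← top_le_iff, ← h, AddSubgroup.closure_le]
    rintro _ ⟨i, rfl⟩
    exact ⟨FreeAbelianGroup.of i, by simp⟩
  set L := FreeAbelianGroup.lift β with hL
  set L' := FreeAbelianGroup.lift β' with hL'
  -- equality of the Gram matrices extends from the generators to the free abelian group on `I`
  have key : ∀ (F : P →+ P →+ B) (F' : P' →+ P' →+ B),
      (∀ i j, F' (β' i) (β' j) = F (β i) (β j)) → ∀ v w, F' (L' v) (L' w) = F (L v) (L w) := by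
    intro F F' h v w
    have h1 : ∀ i, (F' (β' i)).comp L' = (F (β i)).comp L := fun i =>
      FreeAbelianGroup.lift_ext _ _ fun j => by simp [hL, hL', h]
    have h2 : (F'.flip (L' w)).comp L' = (F.flip (L w)).comp L :=
      FreeAbelianGroup.lift_ext _ _ fun i => by
        simpa [hL, hL'] using DFunLike.congr_fun (h1 i) w
    exact DFunLike.congr_fun h2 v
  have hl' : ∀ v w, P'.linner (L' v) (L' w) = P.linner (L v) (L w) :=
    key (AddMonoidHom.mk' P.linnerHom' fun x y => AddMonoidHom.ext fun z =>
        P.linner_add_left x y z)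
      (AddMonoidHom.mk' P'.linnerHom' fun x y => AddMonoidHom.ext fun z =>
        P'.linner_add_left x y z) hl
  have hr' : ∀ v w, P'.rinner (L' v) (L' w) = P.rinner (L v) (L w) :=
    key (AddMonoidHom.mk' P.rinnerHom' fun x y => AddMonoidHom.ext fun z =>
        P.rinner_add_left x y z)
      (AddMonoidHom.mk' P'.rinnerHom' fun x y => AddMonoidHom.ext fun z =>
        P'.rinner_add_left x y z) hr
  have heq : ∀ v w, L v = L w ↔ L' v = L' w := by
    intro v w
    rw [← sub_eq_zero, ← map_sub, ← sub_eq_zero (a := L' v), ← map_sub]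
    constructor
    · intro h
      exact P'.eq_zero_of_linner_self (by rw [hl', h]; exact (P.linnerHom 0).map_zero)
    · intro h
      exact P.eq_zero_of_linner_self (by rw [← hl', h]; exact (P'.linnerHom 0).map_zero)
  have hs := surj β hβ
  have hsi := Function.surjInv_eq hs
  let f : P → P' := fun p => L' (Function.surjInv hs p)
  have hfL : ∀ v, f (L v) = L' v := fun v => (heq _ _).1 (hsi _)
  have hf : Function.Bijective f := by
    refine ⟨fun p q h => ?_, fun q => ?_⟩
    · have := (heq _ _).2 h
      rwa [hsi, hsi] at this
    · obtain ⟨v, rfl⟩ := surj β' hβ' q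
      exact ⟨L v, hfL v⟩
  refine ⟨Iso.ofInner (Equiv.ofBijective f hf)
    (fun x y => by change P'.linner (L' _) (L' _) = _; rw [hl', hsi, hsi])
    (fun x y => by change P'.rinner (L' _) (L' _) = _; rw [hr', hsi, hsi]), fun i => ?_⟩
  have := hfL (FreeAbelianGroup.of i)
  simp only [hL, hL', FreeAbelianGroup.lift_apply_of] at this
  exact this

namespace TensorMap

variable {M N P : MoritaBimodule.{u, w} B} (β : TensorMap M N P)

/-- A tensor map as an additive map in the second variable. -/
def right (m : M) : N →+ P := AddMonoidHom.mk' (β.toFun m) (β.add_right m)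

/-- A tensor map as an additive map in the first variable. -/
def left (n : N) : M →+ P := AddMonoidHom.mk' (β.toFun · n) fun m m' => β.add_left m m' n

lemma addHom_ext {A : Type*} [AddGroup A] {F F' : P →+ A}
    (h : ∀ m n, F (β.toFun m n) = F' (β.toFun m n)) : F = F' := by
  refine AddMonoidHom.eq_of_eqOn_dense (s := Set.range fun p : M × N => β.toFun p.1 p.2)
    β.closure_eq_top ?_
  rintro _ ⟨p, rfl⟩
  exact h _ _

lemma exists_sum (p : P) : ∃ (ι : Type) (_ : Fintype ι) (m : ι → M) (n : ι → N),
    p = ∑ i, β.toFun (m i) (n i) := by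
  have hp : p ∈ AddSubgroup.closure (Set.range fun p : M × N => β.toFun p.1 p.2) := by
    rw [β.closure_eq_top]; trivial
  induction hp using AddSubgroup.closure_induction with
  | mem p hp =>
    obtain ⟨q, rfl⟩ := hp
    exact ⟨Unit, inferInstance, fun _ => q.1, fun _ => q.2, by simp⟩
  | zero => exact ⟨Empty, inferInstance, Empty.elim, Empty.elim, by simp⟩
  | add s t _ _ hs ht =>
    obtain ⟨ι, _, x, y, rfl⟩ := hs
    obtain ⟨κ, _, x', y', rfl⟩ := ht
    exact ⟨ι ⊕ κ, inferInstance, Sum.elim x x', Sum.elim y y', by simp⟩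
  | neg s _ hs =>
    obtain ⟨ι, _, x, y, rfl⟩ := hs
    refine ⟨ι, inferInstance, fun i => -x i, y, ?_⟩
    rw [← Finset.sum_neg_distrib]
    exact Finset.sum_congr rfl fun i _ => (map_neg (β.left (y i)) (x i)).symm

/-- The internal tensor product is unique up to an isomorphism that respects elementary tensors. -/
lemma exists_iso {P' : MoritaBimodule.{u, w} B} (β' : TensorMap M N P') :
    ∃ f : Iso P P', ∀ m n, f (β.toFun m n) = β'.toFun m n := by
  obtain ⟨f, hf⟩ := exists_iso_of_closure _ _ β.closure_eq_top β'.closure_eq_top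
    (fun i j => by rw [β'.linner_map, β.linner_map])
    (fun i j => by rw [β'.rinner_map, β.rinner_map])
  exact ⟨f, fun m n => hf (m, n)⟩

/-- Associativity of the internal tensor product, on elementary tensors. -/
lemma exists_assoc {K MN NK Q Q' : MoritaBimodule.{u, w} B} (β : TensorMap M N MN)
    (γ : TensorMap MN K Q) (β' : TensorMap N K NK) (γ' : TensorMap M NK Q') :
    ∃ f : Iso Q Q', ∀ m n k,
      f (γ.toFun (β.toFun m n) k) = γ'.toFun m (β'.toFun n k) := by
  obtain ⟨f, hf⟩ := exists_iso_of_closure _ _ (β.closure_left γ) (β'.closure_right γ')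
    (fun i j => by
      rw [γ'.linner_map, γ.linner_map, β'.linner_map, ← β.map_r, β.linner_map, N.linner_r_left,
        ← N.linner_r_left])
    (fun i j => by
      rw [γ'.rinner_map, γ.rinner_map, β.rinner_map, ← β'.map_l, β'.rinner_map,
        N.rinner_l_right, ← N.rinner_l_right])
  exact ⟨f, fun m n k => hf (m, n, k)⟩

/-- An element `m` is determined by all `m ⊗ n`, as `ₗ⟨m, t⟩ = ∑ ₗ⟨m ⊗ yᵢ, t ⊗ yᵢ⟩` for a frame `y`
of `N`. -/
lemma left_injective {m m' : M} (h : ∀ n, β.toFun m n = β.toFun m' n) : m = m' := by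
  obtain ⟨ι, _, y, hy⟩ := N.exists_frame
  have key : ∀ m t, M.linner m t = ∑ i, P.linner (β.toFun m (y i)) (β.toFun t (y i)) := by
    intro m t
    simp_rw [β.linner_map]
    rw [← M.linner_sum_left, ← M.r_sum, hy, M.r_one]
  exact M.ext_linner fun t => by simp_rw [key, h]

lemma norm_le (m : M) (n : N) : ‖β.toFun m n‖ ≤ ‖m‖ * ‖n‖ := by
  refine le_of_sq_le_sq ?_ (by positivity)
  rw [P.norm_sq_eq_linner, β.linner_map]
  calc _ ≤ ‖M.r m (N.linner n n)‖ * ‖m‖ := M.norm_linner_le _ _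
    _ ≤ ‖m‖ * ‖N.linner n n‖ * ‖m‖ :=
      mul_le_mul_of_nonneg_right (M.norm_r_le _ _) (norm_nonneg _)
    _ = (‖m‖ * ‖n‖) ^ 2 := by rw [← N.norm_sq_eq_linner]; ring

/-- `M ⊗ B ≅ M`. -/
def selfRight (M : MoritaBimodule.{u, u} B) : TensorMap M (self B) M where
  toFun m b := M.r m b
  add_left m m' b := M.add_r m m' b
  add_right m := M.r_add m
  balanced m b c := (M.r_mul m b c).symm
  map_l b m c := M.l_r b m c
  map_r m b c := M.r_mul m b c
  linner_map := by
    have h : ∀ (m m' : M) (b b' : B),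
        M.linner (M.r m b) (M.r m' b') = M.linner (M.r m (b * star b')) m' := fun m m' b b' => by
      rw [M.linner_r_right, ← M.r_mul]
    exact fun m b m' b' => h m m' b b'
  rinner_map := by
    have h : ∀ (m m' : M) (b b' : B),
        M.rinner (M.r m b) (M.r m' b') = star b * (M.rinner m m' * b') := fun m m' b b' => by
      rw [M.rinner_r_left, M.rinner_r_right]
    exact fun m b m' b' => h m m' b b'
  dense := by
    refine dense_univ.mono fun m _ => Submodule.subset_span ⟨(m, (1 : B)), M.r_one m⟩

variable {M N : MoritaBimodule.{u, u} B}

/-- An inverse `N` of `M` is a dual of `M`: every functional `⟨x, ·⟩ᵣ` on `M` is represented by an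
element of `N`. For `1 = ∑ aᵢ ⊗ nᵢ` in `M ⊗ N`, it is `∑ ⟨x, aᵢ⟩ᵣ nᵢ`. -/
lemma exists_adjoint (β : TensorMap N M (self B)) (γ : TensorMap M N (self B))
    (hβγ : ∀ (a : M) (n : N) (m : M), M.r a (β.toFun n m) = M.l (γ.toFun a n) m) (x : M) :
    ∃ t : N, ∀ m, β.toFun t m = M.rinner x m := by
  obtain ⟨ι, _, a, n, h⟩ := γ.exists_sum (1 : B)
  refine ⟨∑ i, N.l (M.rinner x (a i)) (n i), fun m => ?_⟩
  have h1 : ∀ i, β.toFun (N.l (M.rinner x (a i)) (n i)) m =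
      M.rinner x (M.l (γ.toFun (a i) (n i)) m) := fun i => by
    rw [β.map_l, ← hβγ]
    exact (M.rinner_r_right _ _ _).symm
  have h2 : ∑ i, M.rinner x (M.l (γ.toFun (a i) (n i)) m) = M.rinner x m := by
    rw [← M.rinner_sum_right]
    refine congrArg _ ((M.sum_l _ _ _).symm.trans ?_)
    exact (congrArg (M.l · m) h).symm.trans (M.one_l m)
  refine (map_sum (β.left m) _ _).trans (Eq.trans ?_ h2)
  exact Finset.sum_congr rfl fun i _ => h1 i

/-- If `t` is the adjoint of `x`, then `x` is the adjoint of `t`. -/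
lemma rinner_adjoint (β : TensorMap N M (self B)) (γ : TensorMap M N (self B))
    (hβγ : ∀ (a : M) (n : N) (m : M), M.r a (β.toFun n m) = M.l (γ.toFun a n) m) {x : M} {t : N}
    (ht : ∀ m, β.toFun t m = M.rinner x m) (n : N) : γ.toFun x n = N.rinner t n := by
  refine M.l_injective fun c => M.ext_rinner fun a => ?_
  rw [← hβγ, ← β.rinner_map, ht]
  refine (M.rinner_r_right _ _ _).trans ?_
  rw [← M.star_rinner]
  rfl

/-- The product of `x` with the adjoint of `y` is `ₗ⟨x, y⟩`. -/
lemma linner_eq_of_adjoint (β : TensorMap N M (self B)) (γ : TensorMap M N (self B))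
    (hβγ : ∀ (a : M) (n : N) (m : M), M.r a (β.toFun n m) = M.l (γ.toFun a n) m) {y : M} {t : N}
    (ht : ∀ m, β.toFun t m = M.rinner y m) (x : M) : γ.toFun x t = M.linner x y :=
  M.l_injective fun c => by rw [← hβγ, ht, M.linner_l_eq]

end TensorMap

end MoritaBimodule

/-! ### The total space of a choice -/

namespace Choice

variable {G : Type v} [Group G] {B : Type u} [CStarAlgebra B] {ψ : G →* Pic B}

/-- The disjoint union of the bimodules of a choice. -/
structure Total (L : Choice ψ) : Type (max v u) where
  /-- the degree -/
  deg : G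
  /-- the element of the bimodule of this degree -/
  val : L.X deg

section Total

variable {L : Choice ψ}

/-- The total space as a sigma type. -/
def totalEquiv (L : Choice ψ) : (Σ g, L.X g) ≃ L.Total where
  toFun s := ⟨s.1, s.2⟩
  invFun s := ⟨s.deg, s.val⟩
  left_inv _ := rfl
  right_inv _ := rfl

/-- The (in general nonassociative) multiplication given by the isomorphisms `Ψ g h`. -/
noncomputable instance : Mul L.Total :=
  ⟨fun s t => ⟨s.deg * t.deg, L.Ψ s.deg t.deg (tmul s.val t.val)⟩⟩

lemma mk_inj {g : G} {x y : L.X g} : (⟨g, x⟩ : L.Total) = ⟨g, y⟩ ↔ x = y :=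
  ⟨fun h => eq_of_heq (Total.mk.inj h).2, fun h => h ▸ rfl⟩

/-- The left multiplication by unitary central elements. -/
instance : MulAction (UZ B) L.Total where
  smul z s := ⟨s.deg, (L.X s.deg).l (z.1 : B) s.val⟩
  one_smul s := mk_inj.2 ((L.X s.deg).one_l s.val)
  mul_smul z z' s := mk_inj.2 ((L.X s.deg).mul_l z.1 z'.1 s.val)

variable (L) in
/-- The embedding of `B` as the fiber over `1`. -/
def emb (b : B) : L.Total := ⟨1, L.ι b⟩

lemma smul_mk (z : UZ B) {g : G} (x : L.X g) :
    (z • ⟨g, x⟩ : L.Total) = ⟨g, (L.X g).l (z.1 : B) x⟩ := rfl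

lemma emb_injective : Function.Injective L.emb := fun _ _ h =>
  L.ι.toEquiv.injective (mk_inj.1 h)

lemma emb_mul (b : B) {g : G} (x : L.X g) :
    (L.emb b * ⟨g, x⟩ : L.Total) = ⟨g, (L.X g).l b x⟩ :=
  congrArg L.totalEquiv (L.Ψ_one_left g b x)

lemma mul_emb {g : G} (x : L.X g) (b : B) :
    (⟨g, x⟩ * L.emb b : L.Total) = ⟨g, (L.X g).r x b⟩ :=
  congrArg L.totalEquiv (L.Ψ_one_right g x b)

lemma emb_one_mul (s : L.Total) : L.emb 1 * s = s := by
  obtain ⟨g, x⟩ := s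
  rw [emb_mul, (L.X g).one_l]

lemma mul_emb_one (s : L.Total) : s * L.emb 1 = s := by
  obtain ⟨g, x⟩ := s
  rw [mul_emb, (L.X g).r_one]

variable (L) in
/-- The tensor map `(x, y) ↦ Ψ(x ⊗ y)`. -/
noncomputable def mulMap (g h : G) : TensorMap (L.X g) (L.X h) (L.X (g * h)) :=
  (tensorMap _ _).congr (Iso.refl _) (Iso.refl _) (L.Ψ g h)

lemma smul_mul (z : UZ B) (s t : L.Total) : (z • s) * t = z • (s * t) :=
  mk_inj.2 ((L.mulMap s.deg t.deg).map_l z.1 s.val t.val)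

/-- The group `G` acts on `UZ(B)` through `ψ` by moving scalars to the left. -/
lemma mul_smul' (s : L.Total) (z : UZ B) (t : L.Total) :
    s * (z • t) = ((Pic.toAut B).comp ψ) s.deg z • (s * t) := by
  obtain ⟨g, x⟩ := s
  obtain ⟨h, y⟩ := t
  have h1 : ((Pic.toAut B).comp ψ) g z = (L.X g).twist z := by
    change Pic.toAut B (ψ g) z = _
    rw [← L.mk_X]
    rfl
  rw [h1, ← smul_mul, smul_mk, smul_mk, twist_l]
  exact mk_inj.2 ((L.mulMap g h).balanced x z.1 y).symm

/-- The action of `UZ(B)` is faithful on every single `X g`; by the following lemmas, it is so on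
right-bracketed products of two, three and four elements of prescribed degrees. -/
lemma eq_of_smul {z z' : UZ B} (g : G) (h : ∀ x : L.X g, (z • ⟨g, x⟩ : L.Total) = z' • ⟨g, x⟩) :
    z = z' :=
  Subtype.ext (Subtype.ext ((L.X g).l_injective fun x => mk_inj.1 (h x)))

lemma eq_of_smul_mul {z z' : UZ B} (g h : G)
    (H : ∀ (x : L.X g) (y : L.X h), (z • (⟨g, x⟩ * ⟨h, y⟩) : L.Total) = z' • (⟨g, x⟩ * ⟨h, y⟩)) :
    z = z' := by
  refine eq_of_smul (L := L) (g * h) fun p => mk_inj.2 ?_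
  refine DFunLike.congr_fun (F := L.X (g * h) →+ L.X (g * h)) (f := (L.X (g * h)).lHom _)
    (g := (L.X (g * h)).lHom _) ((L.mulMap g h).addHom_ext fun x y => ?_) p
  exact mk_inj.1 (H x y)

lemma eq_of_smul_mul_mul {z z' : UZ B} (g h k : G)
    (H : ∀ (x : L.X g) (y : L.X h) (t : L.X k),
      (z • (⟨g, x⟩ * (⟨h, y⟩ * ⟨k, t⟩)) : L.Total) = z' • (⟨g, x⟩ * (⟨h, y⟩ * ⟨k, t⟩))) :
    z = z' := by
  refine eq_of_smul_mul (L := L) g (h * k) fun x p => ?_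
  -- with the scalars moved to the first factor, both sides are additive in `p`
  simp only [← smul_mul]
  refine mk_inj.2 ?_
  refine DFunLike.congr_fun (F := L.X (h * k) →+ L.X (g * (h * k)))
    (f := (L.mulMap g (h * k)).right ((L.X g).l (z.1 : B) x))
    (g := (L.mulMap g (h * k)).right ((L.X g).l (z'.1 : B) x))
    ((L.mulMap h k).addHom_ext fun y t => ?_) p
  have := H x y t
  simp only [← smul_mul] at this
  exact mk_inj.1 this

lemma eq_of_smul_mul_mul_mul {z z' : UZ B} (g h k l : G)
    (H : ∀ (x : L.X g) (y : L.X h) (t : L.X k) (r : L.X l),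
      (z • (⟨g, x⟩ * (⟨h, y⟩ * (⟨k, t⟩ * ⟨l, r⟩))) : L.Total) =
        z' • (⟨g, x⟩ * (⟨h, y⟩ * (⟨k, t⟩ * ⟨l, r⟩)))) :
    z = z' := by
  refine eq_of_smul_mul_mul (L := L) g h (k * l) fun x y p => ?_
  simp only [← smul_mul]
  refine mk_inj.2 ?_
  refine DFunLike.congr_fun (F := L.X (k * l) →+ L.X (g * (h * (k * l))))
    (f := ((L.mulMap g (h * (k * l))).right ((L.X g).l (z.1 : B) x)).comp
      ((L.mulMap h (k * l)).right y))
    (g := ((L.mulMap g (h * (k * l))).right ((L.X g).l (z'.1 : B) x)).comp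
      ((L.mulMap h (k * l)).right y))
    ((L.mulMap k l).addHom_ext fun t r => ?_) p
  have := H x y t r
  simp only [← smul_mul] at this
  exact mk_inj.1 this

end Total

/-! ### Existence of choices -/

/-- The tensor maps between given representatives can be normalized: over `(1, h)` and `(g, 1)` the
left and the right action are used, and these agree over `(1, 1)`. -/
lemma exists_normalized_iso {X : G → MoritaBimodule.{u, u} B} (hX : ∀ g, Pic.mk (X g) = ψ g)
    (ι : Iso (self B) (X 1)) (g h : G) :
    ∃ f : Iso (tensor (X g) (X h)) (X (g * h)),
      (∀ (s : X g) (b : B), (⟨g, s⟩ : Σ g, X g) = ⟨1, ι b⟩ → ∀ x : X h,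
        (⟨g * h, f (tmul s x)⟩ : Σ g, X g) = ⟨h, (X h).l b x⟩) ∧
      ∀ (t : X h) (b : B), (⟨h, t⟩ : Σ g, X g) = ⟨1, ι b⟩ → ∀ x : X g,
        (⟨g * h, f (tmul x t)⟩ : Σ g, X g) = ⟨g, (X g).r x b⟩ := by
  by_cases hg : g = 1
  · subst hg
    obtain ⟨c, hc⟩ := exists_iso_of_eq X (one_mul h).symm
    obtain ⟨f, hf⟩ := (tensorMap (X 1) (X h)).exists_iso
      ((TensorMap.selfLeft (X h)).congr ι.symm (Iso.refl _) c)
    have hf' : ∀ (b : B) (x : X h),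
        (⟨1 * h, f (tmul (ι b) x)⟩ : Σ g, X g) = ⟨h, (X h).l b x⟩ := fun b x => by
      refine Eq.trans ?_ (hc _)
      refine Sigma.ext rfl (heq_of_eq ((hf _ _).trans ?_))
      exact congrArg (fun a => c ((X h).l a x)) (ι.toEquiv.symm_apply_apply b)
    refine ⟨f, fun s b hs x => ?_, fun t b ht x => ?_⟩
    · cases hs
      exact hf' b x
    · obtain ⟨a, rfl⟩ := ι.toEquiv.surjective x
      cases ht
      refine (hf' a (ι b)).trans ?_
      exact Sigma.ext rfl (heq_of_eq ((ι.map_l a b).symm.trans (ι.map_r a b)))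
  · by_cases hh : h = 1
    · subst hh
      obtain ⟨c, hc⟩ := exists_iso_of_eq X (mul_one g).symm
      obtain ⟨f, hf⟩ := (tensorMap (X g) (X 1)).exists_iso
        ((TensorMap.selfRight (X g)).congr (Iso.refl _) ι.symm c)
      refine ⟨f, fun s b hs => absurd (Sigma.mk.inj hs).1 hg, fun t b ht x => ?_⟩
      cases ht
      refine Eq.trans ?_ (hc _)
      refine Sigma.ext rfl (heq_of_eq ((hf _ _).trans ?_))
      exact congrArg (fun a => c ((X g).r x a)) (ι.toEquiv.symm_apply_apply b)
    · obtain ⟨f⟩ := Pic.mk_eq_mk.1 (show Pic.mk (tensor (X g) (X h)) = Pic.mk (X (g * h)) by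
        rw [← Pic.mk_mul_mk, hX, hX, hX, map_mul])
      exact ⟨f, fun s b hs => absurd (Sigma.mk.inj hs).1 hg,
        fun t b ht => absurd (Sigma.mk.inj ht).1 hh⟩

variable (ψ) in
theorem nonempty_choice : Nonempty (Choice ψ) := by
  have hX : ∀ g, ∃ M, Pic.mk M = ψ g := fun g => Quotient.exists_rep (ψ g)
  choose X hX using hX
  obtain ⟨ι⟩ := Pic.mk_eq_mk.1 (show Pic.mk (self B) = Pic.mk (X 1) by rw [hX, map_one]; rfl)
  choose Ψ h1 h2 using exists_normalized_iso hX ι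
  exact ⟨⟨X, hX, ι, Ψ, fun g b x => h1 1 g _ b rfl x, fun g x b => h2 g 1 _ b rfl x⟩⟩

/-! ### The associativity defect -/

variable {L L' : Choice ψ} {ω ω' : (Fin 3 → G) → UZ B}

lemma isDefect_iff : L.IsDefect ω ↔
    ∀ s t r : L.Total, (s * t) * r = ω ![s.deg, t.deg, r.deg] • (s * (t * r)) :=
  ⟨fun h s t r => congrArg L.totalEquiv (h _ _ _ s.val t.val r.val),
    fun h g k l x y z => congrArg L.totalEquiv.symm (h ⟨g, x⟩ ⟨k, y⟩ ⟨l, z⟩)⟩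

lemma IsDefect.unique (hω : L.IsDefect ω) (hω' : L.IsDefect ω') : ω = ω' := by
  funext v
  have hv : v = ![v 0, v 1, v 2] := by ext i; fin_cases i <;> rfl
  rw [hv]
  refine Choice.eq_of_smul_mul_mul (L := L) (v 0) (v 1) (v 2) fun x y t => ?_
  exact (isDefect_iff.1 hω _ _ _).symm.trans (isDefect_iff.1 hω' _ _ _)

variable (L) in
theorem exists_isDefect : ∃ ω, L.IsDefect ω := by
  have key : ∀ g h k : G, ∃ z : UZ B, ∀ (x : L.X g) (y : L.X h) (t : L.X k),
      ((⟨g, x⟩ * ⟨h, y⟩) * ⟨k, t⟩ : L.Total) = z • (⟨g, x⟩ * (⟨h, y⟩ * ⟨k, t⟩)) := by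
    intro g h k
    obtain ⟨f, hf⟩ := (L.mulMap g h).exists_assoc (L.mulMap (g * h) k) (L.mulMap h k)
      (L.mulMap g (h * k))
    obtain ⟨c, hc⟩ := exists_iso_of_eq L.X (mul_assoc g h k)
    obtain ⟨z, hz⟩ := (f.symm.trans c).exists_eq_l
    refine ⟨z, fun x y t => ?_⟩
    refine Eq.trans (congrArg L.totalEquiv (hc _).symm) (mk_inj.2 (Eq.trans ?_ (hz _)))
    change _ = c (f.toEquiv.symm ((L.mulMap g (h * k)).toFun x ((L.mulMap h k).toFun y t)))
    rw [← hf, Equiv.symm_apply_apply]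
    rfl
  choose z hz using key
  exact ⟨fun v => z (v 0) (v 1) (v 2), fun g h k x y t =>
    congrArg L.totalEquiv.symm (hz g h k x y t)⟩

/-- The cocycle identity compares the two ways of moving all brackets in `((s t) r) q` to the
right. -/
theorem IsDefect.mem_cocycles (hω : L.IsDefect ω) :
    ω ∈ cocycles ((Pic.toAut B).comp ψ) 3 := by
  rw [isDefect_iff] at hω
  refine ⟨?_, ?_⟩
  · intro v hv
    have hv3 : v = ![v 0, v 1, v 2] := by ext i; fin_cases i <;> rfl
    obtain ⟨i, hi⟩ := hv
    rw [hv3]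
    fin_cases i
    · replace hi : v 0 = 1 := hi
      rw [hi]
      refine eq_of_smul_mul (L := L) (v 1) (v 2) fun x y => ?_
      have := hω (L.emb 1) ⟨_, x⟩ ⟨_, y⟩
      rw [emb_one_mul, emb_one_mul] at this
      rw [one_smul]
      exact this.symm
    · replace hi : v 1 = 1 := hi
      rw [hi]
      refine eq_of_smul_mul (L := L) (v 0) (v 2) fun x y => ?_
      have := hω ⟨_, x⟩ (L.emb 1) ⟨_, y⟩
      rw [emb_one_mul, mul_emb_one] at this
      rw [one_smul]
      exact this.symm
    · replace hi : v 2 = 1 := hi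
      rw [hi]
      refine eq_of_smul_mul (L := L) (v 0) (v 1) fun x y => ?_
      have := hω ⟨_, x⟩ ⟨_, y⟩ (L.emb 1)
      rw [mul_emb_one, mul_emb_one] at this
      rw [one_smul]
      exact this.symm
  · refine MonoidHom.mem_ker.2 (funext fun v => ?_)
    set S := (Pic.toAut B).comp ψ with hS
    have key : ω ![v 0, v 1, v 2] * (ω ![v 0, v 1 * v 2, v 3] * S (v 0) (ω ![v 1, v 2, v 3])) =
        ω ![v 0 * v 1, v 2, v 3] * ω ![v 0, v 1, v 2 * v 3] := by
      refine eq_of_smul_mul_mul_mul (L := L) (v 0) (v 1) (v 2) (v 3) fun x y t r => ?_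
      have h1 := hω ⟨_, x⟩ ⟨_, y⟩ ⟨_, t⟩
      have h2 := hω ⟨_, x⟩ (⟨_, y⟩ * ⟨_, t⟩) ⟨_, r⟩
      have h3 := hω ⟨_, y⟩ ⟨_, t⟩ ⟨_, r⟩
      have h4 := hω (⟨_, x⟩ * ⟨_, y⟩) ⟨_, t⟩ ⟨_, r⟩
      have h5 := hω ⟨_, x⟩ ⟨_, y⟩ (⟨_, t⟩ * ⟨_, r⟩)
      rw [h5, h1, smul_mul, h2, h3, mul_smul'] at h4
      simp only [mul_smul]
      exact h4
    have e0 : (fun i : Fin 3 => v i.succ) = ![v 1, v 2, v 3] := by ext i; fin_cases i <;> rfl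
    have e1 : Fin.contractNth 0 (· * ·) v = ![v 0 * v 1, v 2, v 3] := by
      ext i; fin_cases i <;> rfl
    have e2 : Fin.contractNth 1 (· * ·) v = ![v 0, v 1 * v 2, v 3] := by
      ext i; fin_cases i <;> rfl
    have e3 : Fin.contractNth 2 (· * ·) v = ![v 0, v 1, v 2 * v 3] := by
      ext i; fin_cases i <;> rfl
    have e4 : Fin.contractNth 3 (· * ·) v = ![v 0, v 1, v 2] := by
      ext i; fin_cases i <;> rfl
    change S (v 0) (ω fun i => v i.succ) *
      ∏ j : Fin 4, ω (Fin.contractNth j (· * ·) v) ^ ((-1 : ℤ) ^ ((j : ℕ) + 1)) = 1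
    rw [Fin.prod_univ_four, e0, e1, e2, e3, e4]
    norm_num
    calc _ = ω ![v 0, v 1, v 2] * (ω ![v 0, v 1 * v 2, v 3] * S (v 0) (ω ![v 1, v 2, v 3])) *
          (ω ![v 0 * v 1, v 2, v 3] * ω ![v 0, v 1, v 2 * v 3])⁻¹ := by rw [mul_inv]; ac_rfl
      _ = 1 := by rw [key, mul_inv_cancel]

/-! ### Comparison of choices -/

/-- A family of isomorphisms between the bimodules of two choices, as a map of total spaces. -/
def mapTotal (θ : ∀ g, Iso (L.X g) (L'.X g)) (s : L.Total) : L'.Total := ⟨s.deg, θ s.deg s.val⟩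

lemma mapTotal_smul (θ : ∀ g, Iso (L.X g) (L'.X g)) (z : UZ B) (s : L.Total) :
    mapTotal θ (z • s) = z • mapTotal θ s :=
  mk_inj.2 ((θ s.deg).map_l z.1 s.val)

/-- If the multiplications of two choices differ by `ρ`, their defects differ by the
differential of `ρ`. -/
theorem IsDefect.eq_mul_differential (hω : L.IsDefect ω) (hω' : L'.IsDefect ω')
    (θ : ∀ g, Iso (L.X g) (L'.X g)) (ρ : (Fin 2 → G) → UZ B)
    (hρ : ∀ s t, mapTotal θ s * mapTotal θ t = ρ ![s.deg, t.deg] • mapTotal θ (s * t)) :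
    ω = ω' * differential ((Pic.toAut B).comp ψ) 2 ρ := by
  rw [isDefect_iff] at hω hω'
  funext v
  set S := (Pic.toAut B).comp ψ with hS
  have key : ρ ![v 0, v 1] * (ρ ![v 0 * v 1, v 2] * ω ![v 0, v 1, v 2]) =
      ω' ![v 0, v 1, v 2] * (S (v 0) (ρ ![v 1, v 2]) * ρ ![v 0, v 1 * v 2]) := by
    refine Choice.eq_of_smul_mul_mul (L := L) (v 0) (v 1) (v 2) fun x y t => ?_
    have hinj : Function.Injective (mapTotal θ) := by
      rintro ⟨g, a⟩ ⟨h, b⟩ hab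
      obtain rfl : g = h := (Total.mk.inj hab).1
      exact mk_inj.2 ((θ g).toEquiv.injective (mk_inj.1 hab))
    apply hinj
    have h1 := hω' (mapTotal θ ⟨_, x⟩) (mapTotal θ ⟨_, y⟩) (mapTotal θ ⟨_, t⟩)
    rw [hρ, smul_mul, hρ, hρ, mul_smul', hρ, hω, mapTotal_smul] at h1
    simp only [mapTotal_smul, mul_smul]
    exact h1
  have hv3 : v = ![v 0, v 1, v 2] := by ext i; fin_cases i <;> rfl
  have e0 : (fun i : Fin 2 => v i.succ) = ![v 1, v 2] := by ext i; fin_cases i <;> rfl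
  have e1 : Fin.contractNth 0 (· * ·) v = ![v 0 * v 1, v 2] := by
    ext i; fin_cases i <;> rfl
  have e2 : Fin.contractNth 1 (· * ·) v = ![v 0, v 1 * v 2] := by
    ext i; fin_cases i <;> rfl
  have e3 : Fin.contractNth 2 (· * ·) v = ![v 0, v 1] := by
    ext i; fin_cases i <;> rfl
  change ω v = ω' v * (S (v 0) (ρ fun i => v i.succ) *
    ∏ j : Fin 3, ρ (Fin.contractNth j (· * ·) v) ^ ((-1 : ℤ) ^ ((j : ℕ) + 1)))
  rw [Fin.prod_univ_three, e0, e1, e2, e3]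
  rw [← hv3] at key
  norm_num
  calc ω v = ρ ![v 0, v 1] * (ρ ![v 0 * v 1, v 2] * ω v) *
        (ρ ![v 0, v 1] * ρ ![v 0 * v 1, v 2])⁻¹ := by
        rw [← mul_assoc (ρ ![v 0, v 1]), mul_comm, inv_mul_cancel_left]
    _ = _ := by rw [key, mul_inv]; ac_rfl

variable (L L') in
/-- Any two choices differ by a normalized `2`-cochain, which measures how far isomorphisms between
their representatives are from being multiplicative. -/
theorem exists_comparison : ∃ (θ : ∀ g, Iso (L.X g) (L'.X g)) (ρ : (Fin 2 → G) → UZ B),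
    ρ ∈ cochains G (UZ B) 2 ∧
    ∀ s t, mapTotal θ s * mapTotal θ t = ρ ![s.deg, t.deg] • mapTotal θ (s * t) := by
  have h0 : ∀ g, ∃ f : Iso (L.X g) (L'.X g), ∀ (x : L.X g) (b : B),
      (⟨g, x⟩ : L.Total) = L.emb b → (⟨g, f x⟩ : L'.Total) = L'.emb b := by
    intro g
    by_cases hg : g = 1
    · subst hg
      refine ⟨L.ι.symm.trans L'.ι, fun x b hx => ?_⟩
      cases hx
      refine mk_inj.2 ?_
      exact congrArg L'.ι (L.ι.toEquiv.symm_apply_apply b)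
    · obtain ⟨f⟩ := Pic.mk_eq_mk.1 ((L.mk_X g).trans (L'.mk_X g).symm)
      exact ⟨f, fun x b hx => absurd (Total.mk.inj hx).1 hg⟩
  choose θ hθ using h0
  have h1 : ∀ g h, ∃ z : UZ B, ∀ (x : L.X g) (y : L.X h),
      mapTotal θ ⟨g, x⟩ * mapTotal θ ⟨h, y⟩ = z • mapTotal θ (⟨g, x⟩ * ⟨h, y⟩) := by
    intro g h
    obtain ⟨f, hf⟩ := (L.mulMap g h).exists_iso
      ((L'.mulMap g h).congr (θ g) (θ h) (θ (g * h)).symm)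
    obtain ⟨z, hz⟩ := f.exists_eq_l
    refine ⟨z, fun x y => ?_⟩
    rw [← mapTotal_smul]
    refine mk_inj.2 (((θ (g * h)).toEquiv.symm_apply_eq).1 ?_)
    exact (hf x y).symm.trans (hz _)
  choose ρ hρ using h1
  have hemb : mapTotal θ (L.emb 1) = L'.emb 1 := hθ 1 _ 1 rfl
  refine ⟨θ, fun v => ρ (v 0) (v 1), fun v hv => ?_, fun s t => hρ s.deg t.deg s.val t.val⟩
  have hsurj : ∀ {g} (y : L'.X g), ∃ x : L.X g, mapTotal θ ⟨g, x⟩ = ⟨g, y⟩ := fun {g} y => by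
    obtain ⟨x, rfl⟩ := (θ g).toEquiv.surjective y
    exact ⟨x, rfl⟩
  obtain ⟨i, hi⟩ := hv
  fin_cases i
  · replace hi : v 0 = 1 := hi
    change ρ (v 0) (v 1) = 1
    rw [hi]
    refine eq_of_smul (L := L') (v 1) fun y => ?_
    obtain ⟨x, hx⟩ := hsurj y
    have := hρ 1 (v 1) (L.ι (1 : B)) x
    change mapTotal θ (L.emb 1) * _ = _ • mapTotal θ (L.emb 1 * _) at this
    rw [hemb, emb_one_mul, emb_one_mul, hx] at this
    rw [one_smul]
    exact this.symm
  · replace hi : v 1 = 1 := hi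
    change ρ (v 0) (v 1) = 1
    rw [hi]
    refine eq_of_smul (L := L') (v 0) fun y => ?_
    obtain ⟨x, hx⟩ := hsurj y
    have := hρ (v 0) 1 x (L.ι (1 : B))
    change _ * mapTotal θ (L.emb 1) = _ • mapTotal θ (_ * L.emb 1) at this
    rw [hemb, mul_emb_one, mul_emb_one, hx] at this
    rw [one_smul]
    exact this.symm

/-- The class of the defect does not depend on the choice. -/
theorem IsDefect.mk_eq_mk (hω : L.IsDefect ω) (hω' : L'.IsDefect ω') :
    (QuotientGroup.mk ⟨ω, hω.mem_cocycles⟩ : PicCohomology ψ 3) =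
      QuotientGroup.mk ⟨ω', hω'.mem_cocycles⟩ := by
  obtain ⟨θ, ρ, hρ, h⟩ := exists_comparison L' L
  refine QuotientGroup.eq.2 (Subgroup.mem_subgroupOf.2 ⟨ρ, hρ, ?_⟩)
  change _ = ω⁻¹ * ω'
  rw [hω'.eq_mul_differential hω θ ρ h, inv_mul_cancel_left]

variable (L) in
/-- The choice with multiplication changed by a normalized `2`-cochain. -/
noncomputable def twist (ρ : (Fin 2 → G) → UZ B) (hρ : ρ ∈ cochains G (UZ B) 2) : Choice ψ where
  X := L.X
  mk_X := L.mk_X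
  ι := L.ι
  Ψ g h := (L.Ψ g h).trans ((L.X (g * h)).lIso (ρ ![g, h]))
  Ψ_one_left g b x := by
    have h1 : ρ ![1, g] = 1 := hρ _ ⟨0, rfl⟩
    refine Eq.trans ?_ (L.Ψ_one_left g b x)
    rw [h1]
    exact Sigma.ext rfl (heq_of_eq ((L.X (1 * g)).one_l _))
  Ψ_one_right g x b := by
    have h1 : ρ ![g, 1] = 1 := hρ _ ⟨1, rfl⟩
    refine Eq.trans ?_ (L.Ψ_one_right g x b)
    rw [h1]
    exact Sigma.ext rfl (heq_of_eq ((L.X (g * 1)).one_l _))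

/-- If the defect is the differential of `ρ`, twisting by `ρ` makes the multiplication
associative. -/
theorem IsDefect.exists_isDefect_one (hω : L.IsDefect ω)
    (h : ω ∈ coboundaries ((Pic.toAut B).comp ψ) 3) : ∃ L' : Choice ψ, L'.IsDefect 1 := by
  obtain ⟨ρ, hρ, rfl⟩ := h
  obtain ⟨ω', hω'⟩ := exists_isDefect (L.twist ρ hρ)
  have := hω.eq_mul_differential hω' (fun g => Iso.refl (L.X g)) ρ fun s t => rfl
  obtain rfl : ω' = 1 := by simpa using this
  exact ⟨_, hω'⟩

end Choice

/-! ### The choice defined by a saturated Fell bundle -/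

namespace SaturatedFellBundle

variable {G : Type v} [Group G] {B : Type u} [CStarAlgebra B]
  {𝓑 : SaturatedFellBundle.{u, v, w} G B}

/-- The isometry `e` is an isomorphism of `M` with the fiber over `g`, as a Morita equivalence
bimodule. -/
structure IsFiberIso {M : MoritaBimodule.{u, w'} B} {g : G} (e : M ≃ₗᵢ[ℂ] 𝓑.Fib g) : Prop where
  map_l : ∀ b x, e (M.l b x) = lact b (e x)
  map_r : ∀ x b, e (M.r x b) = ract (e x) b
  linn_map : ∀ x y, linn (e x) (e y) = M.linner x y
  rinn_map : ∀ x y, rinn (e x) (e y) = M.rinner x y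

lemma exists_isFiberIso {M : MoritaBimodule.{u, w'} B} {g : G}
    (f : Iso M (𝓑.fiberBimodule g)) : ∃ e : M ≃ₗᵢ[ℂ] 𝓑.Fib g, IsFiberIso e :=
  ⟨f.toLinearIsometryEquiv, f.map_l, f.map_r, f.linner_map, f.rinner_map⟩

variable (𝓑) in
lemma isFiberIso_unit : IsFiberIso (M := self B) 𝓑.unit where
  map_l b x := Subtype.ext (𝓑.unit_mul b x)
  map_r x b := Subtype.ext (𝓑.unit_mul x b)
  linn_map := by
    have h : ∀ x y : B, linn (𝓑.unit x) (𝓑.unit y) = x * star y := fun x y =>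
      ext_unit (𝓑 := 𝓑) (by rw [unit_linn, 𝓑.unit_mul, 𝓑.unit_star])
    exact h
  rinn_map := by
    have h : ∀ x y : B, rinn (𝓑.unit x) (𝓑.unit y) = star x * y := fun x y =>
      ext_unit (𝓑 := 𝓑) (by rw [unit_rinn, 𝓑.unit_mul, 𝓑.unit_star])
    exact h

/-- Two bimodules isomorphic to the same fiber are isomorphic. -/
noncomputable def IsFiberIso.iso {M : MoritaBimodule.{u, w'} B} {N : MoritaBimodule.{u, w'} B}
    {g : G} {e : M ≃ₗᵢ[ℂ] 𝓑.Fib g} {e' : N ≃ₗᵢ[ℂ] 𝓑.Fib g} (he : IsFiberIso e)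
    (he' : IsFiberIso e') : Iso M N :=
  Iso.ofInner (e.toEquiv.trans e'.symm.toEquiv)
    (fun x y => by
      change N.linner (e'.symm (e x)) (e'.symm (e y)) = _
      rw [← he'.linn_map, e'.apply_symm_apply, e'.apply_symm_apply, he.linn_map])
    (fun x y => by
      change N.rinner (e'.symm (e x)) (e'.symm (e y)) = _
      rw [← he'.rinn_map, e'.apply_symm_apply, e'.apply_symm_apply, he.rinn_map])

variable {M N P : MoritaBimodule.{u, w'} B} {g h : G} {e : M ≃ₗᵢ[ℂ] 𝓑.Fib g}
  {e' : N ≃ₗᵢ[ℂ] 𝓑.Fib h} {e'' : P ≃ₗᵢ[ℂ] 𝓑.Fib (g * h)}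

/-- The multiplication `B_g × B_h → B_{gh}` of a saturated Fell bundle, transported to bimodules
isomorphic to the fibers. -/
noncomputable def fiberTensorMap (he : IsFiberIso e) (he' : IsFiberIso e')
    (he'' : IsFiberIso e'') : TensorMap M N P where
  toFun x y := e''.symm (fmul (e x) (e' y))
  add_left x x' y := by rw [map_add, 𝓑.add_fmul, map_add]
  add_right x y y' := by rw [map_add, 𝓑.fmul_add, map_add]
  balanced x b y := by
    rw [he.map_r, he'.map_l]
    exact congrArg _ (Subtype.ext (mul_assoc _ _ _))
  map_l b x y := by
    rw [he.map_l, e''.symm_apply_eq, he''.map_l, e''.apply_symm_apply]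
    exact Subtype.ext (mul_assoc _ _ _)
  map_r x y b := by
    rw [he'.map_r, e''.symm_apply_eq, he''.map_r, e''.apply_symm_apply]
    exact Subtype.ext (mul_assoc _ _ _).symm
  linner_map x y x' y' := by
    rw [← he''.linn_map, ← he'.linn_map, ← he.linn_map, e''.apply_symm_apply,
      e''.apply_symm_apply, he.map_r]
    refine ext_unit (𝓑 := 𝓑) ?_
    rw [unit_linn, unit_linn, ract_val, unit_linn]
    change _ * _ * star (_ * _) = _
    rw [star_mul]
    simp only [mul_assoc]
  rinner_map x y x' y' := by
    rw [← he''.rinn_map, ← he'.rinn_map, ← he.rinn_map, e''.apply_symm_apply,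
      e''.apply_symm_apply, he'.map_l]
    refine ext_unit (𝓑 := 𝓑) ?_
    rw [unit_rinn, unit_rinn, lact_val, unit_rinn]
    change star (_ * _) * (_ * _) = _
    rw [star_mul]
    simp only [mul_assoc]
  dense := by
    refine (e''.symm.surjective.denseRange.dense_image e''.symm.continuous
      (𝓑.saturated g h)).mono ?_
    rintro _ ⟨s, hs, rfl⟩
    have h1 := Submodule.mem_map_of_mem
      (f := (e''.symm.toLinearEquiv : 𝓑.Fib (g * h) →ₗ[ℂ] P)) hs
    rw [Submodule.map_span] at h1
    refine Submodule.span_mono ?_ h1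
    rintro _ ⟨_, ⟨⟨s, t⟩, rfl⟩, rfl⟩
    obtain ⟨x, rfl⟩ := e.surjective s
    obtain ⟨y, rfl⟩ := e'.surjective t
    exact ⟨(x, y), rfl⟩

/-- The multiplication of a Fell bundle is associative, so the choice it defines has trivial
defect. -/
theorem HasPicard.exists_isDefect_one {ψ : G →* Pic B} (h : 𝓑.HasPicard ψ) :
    ∃ L : Choice ψ, L.IsDefect 1 := by
  choose X hX hf using h
  choose e he using fun g => exists_isFiberIso (hf g).some
  -- equalities between elements of different `X g` can be tested in the total space of the bundle
  have key : ∀ {g h : G} (x : X g) (y : X h), (e g x).1 = (e h y).1 →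
      (⟨g, x⟩ : Σ g, X g) = ⟨h, y⟩ := by
    intro g h x y hxy
    obtain rfl : g = h := by rw [← (e g x).2, hxy, (e h y).2]
    exact Sigma.ext rfl (heq_of_eq ((e g).injective (Subtype.ext hxy)))
  choose Ψ hΨ using fun g h => (tensorMap (X g) (X h)).exists_iso
    (fiberTensorMap (he g) (he h) (he (g * h)))
  have hΨ' : ∀ {g h : G} (x : X g) (y : X h), (e (g * h) (Ψ g h (tmul x y))).1 =
      (e g x).1 * (e h y).1 := fun {g h} x y =>
    congrArg Subtype.val (((e (g * h)).eq_symm_apply).1 (hΨ g h x y))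
  let ι : Iso (self B) (X 1) := (isFiberIso_unit 𝓑).iso (he 1)
  have hι : ∀ b : B, (e 1 (ι b)).1 = (𝓑.unit b).1 := fun b =>
    congrArg Subtype.val ((e 1).apply_symm_apply (𝓑.unit b))
  refine ⟨⟨X, hX, ι, Ψ, fun g b x => key _ _ ?_, fun g x b => key _ _ ?_⟩,
    fun g h k x y z => key _ _ ?_⟩
  · rw [hΨ', hι, (he g).map_l, lact_val]
  · rw [hΨ', hι, (he g).map_r, ract_val]
  · have h1 : ∀ p, (X (g * (h * k))).l (((1 : (Fin 3 → G) → UZ B) ![g, h, k]).1 : B) p = p :=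
      (X (g * (h * k))).one_l
    dsimp only
    rw [h1, hΨ', hΨ', hΨ', hΨ', mul_assoc]

end SaturatedFellBundle

/-! ### The saturated Fell bundle defined by an associative choice -/

namespace Choice

variable {G : Type v} [Group G] {B : Type u} [CStarAlgebra B] {ψ : G →* Pic B} {L : Choice ψ}

lemma IsDefect.assoc (hL : L.IsDefect 1) (s t r : L.Total) : (s * t) * r = s * (t * r) :=
  (isDefect_iff.1 hL s t r).trans (one_smul _ _)

lemma norm_eq_of_mk_eq {g h : G} {x : L.X g} {y : L.X h} (e : (⟨g, x⟩ : L.Total) = ⟨h, y⟩) :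
    ‖x‖ = ‖y‖ := by
  cases e
  rfl

variable (L) in
lemma norm_ι (b : B) : ‖L.ι b‖ = ‖b‖ := L.ι.norm_map b

variable (L) in
/-- For `g h = 1` the multiplication of `X g` and `X h` has values in `B`. -/
lemma exists_pairing {g h : G} (e : g * h = 1) : ∃ β : TensorMap (L.X g) (L.X h) (self B),
    ∀ x y, L.emb (β.toFun x y) = ⟨g, x⟩ * ⟨h, y⟩ := by
  obtain ⟨c, hc⟩ := exists_iso_of_eq L.X e
  refine ⟨(L.mulMap g h).congr (Iso.refl _) (Iso.refl _) (c.trans L.ι.symm), fun x y => ?_⟩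
  exact (mk_inj.2 (L.ι.toEquiv.apply_symm_apply _)).trans (congrArg L.totalEquiv (hc _))

/-- The associativity `a (n m) = (a n) m` in terms of the pairings of `X g` and its inverse
`X h`. -/
lemma IsDefect.r_pairing (hL : L.IsDefect 1) {g h : G}
    {β : TensorMap (L.X h) (L.X g) (self B)} {γ : TensorMap (L.X g) (L.X h) (self B)}
    (hβ : ∀ x y, L.emb (β.toFun x y) = ⟨h, x⟩ * ⟨g, y⟩)
    (hγ : ∀ x y, L.emb (γ.toFun x y) = ⟨g, x⟩ * ⟨h, y⟩) (a : L.X g) (n : L.X h) (m : L.X g) :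
    (L.X g).r a (β.toFun n m) = (L.X g).l (γ.toFun a n) m := by
  refine mk_inj.1 ((mul_emb _ _).symm.trans (Eq.trans ?_ (emb_mul _ _)))
  exact (congrArg (_ * ·) (hβ n m)).trans
    ((hL.assoc _ _ _).symm.trans (congrArg (· * _) (hγ a n).symm))

lemma IsDefect.exists_adj (hL : L.IsDefect 1) {g : G} (x : L.X g) : ∃ t : L.X g⁻¹,
    ∀ y : L.X g, (⟨g⁻¹, t⟩ * ⟨g, y⟩ : L.Total) = L.emb ((L.X g).rinner x y) := by
  obtain ⟨β, hβ⟩ := L.exists_pairing (inv_mul_cancel g)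
  obtain ⟨γ, hγ⟩ := L.exists_pairing (mul_inv_cancel g)
  obtain ⟨t, ht⟩ := TensorMap.exists_adjoint β γ (hL.r_pairing hβ hγ) x
  exact ⟨t, fun y => by rw [← ht, hβ]⟩

variable (hL : L.IsDefect 1)

/-- The adjoint of `x ∈ X g`, the element `x⋆` of `X g⁻¹` with `x⋆ y = ⟨x, y⟩ᵣ` for all `y`. -/
noncomputable def adj {g : G} (x : L.X g) : L.X g⁻¹ := (hL.exists_adj x).choose

/-- The adjoint as an operation on the total space. -/
noncomputable def adjTotal (s : L.Total) : L.Total := ⟨s.deg⁻¹, adj hL s.val⟩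

lemma adj_mul {g : G} (x y : L.X g) :
    (⟨g⁻¹, adj hL x⟩ * ⟨g, y⟩ : L.Total) = L.emb ((L.X g).rinner x y) :=
  (hL.exists_adj x).choose_spec y

/-- The pairing of `X g⁻¹` and `X g`, together with its values on adjoints. -/
lemma exists_adj_pairing (g : G) : ∃ β : TensorMap (L.X g⁻¹) (L.X g) (self B),
    (∀ n m, L.emb (β.toFun n m) = ⟨g⁻¹, n⟩ * ⟨g, m⟩) ∧
      ∀ x m, β.toFun (adj hL x) m = (L.X g).rinner x m := by
  obtain ⟨β, hβ⟩ := L.exists_pairing (inv_mul_cancel g)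
  exact ⟨β, hβ, fun x m => emb_injective (B := B) ((hβ _ m).trans (adj_mul hL x m))⟩

/-- The adjoint is characterized by its defining formula, in whatever form the degree `g⁻¹` is
given. -/
lemma eq_adj {g h : G} (e : h * g = 1) {t : L.X h} {x : L.X g}
    (H : ∀ y : L.X g, (⟨h, t⟩ * ⟨g, y⟩ : L.Total) = L.emb ((L.X g).rinner x y)) :
    (⟨h, t⟩ : L.Total) = ⟨g⁻¹, adj hL x⟩ := by
  obtain rfl : h = g⁻¹ := eq_inv_of_mul_eq_one_left e
  obtain ⟨β, hβ, hβ'⟩ := exists_adj_pairing hL g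
  refine mk_inj.2 (β.left_injective fun y => emb_injective (B := B) (L := L) ?_)
  rw [hβ, H, hβ, adj_mul]

lemma adj_add {g : G} (x y : L.X g) : adj hL (x + y) = adj hL x + adj hL y := by
  obtain ⟨β, -, hβ⟩ := exists_adj_pairing hL g
  refine β.left_injective fun m => ?_
  rw [β.add_left, hβ, hβ, hβ]
  exact (L.X g).rinner_add_left x y m

lemma adj_smul {g : G} (z : ℂ) (x : L.X g) : adj hL (z • x) = star z • adj hL x := by
  obtain ⟨β, -, hβ⟩ := exists_adj_pairing hL g
  refine β.left_injective fun m => ?_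
  rw [← (L.X g⁻¹).l_smul_eq, β.map_l, hβ, hβ, ← (L.X g).r_smul_eq, (L.X g).rinner_r_left,
    star_smul, star_one]
  rfl

lemma mul_adj {g : G} (x y : L.X g) :
    (⟨g, x⟩ * ⟨g⁻¹, adj hL y⟩ : L.Total) = L.emb ((L.X g).linner x y) := by
  obtain ⟨β, hβ, hβ'⟩ := exists_adj_pairing hL g
  obtain ⟨γ, hγ⟩ := L.exists_pairing (mul_inv_cancel g)
  rw [← hγ]
  exact congrArg L.emb (TensorMap.linner_eq_of_adjoint β γ (hL.r_pairing hβ hγ) (hβ' y) x)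

lemma adjTotal_adjTotal (s : L.Total) : adjTotal hL (adjTotal hL s) = s := by
  obtain ⟨g, x⟩ := s
  obtain ⟨β, hβ, hβ'⟩ := exists_adj_pairing hL g
  obtain ⟨γ, hγ⟩ := L.exists_pairing (mul_inv_cancel g)
  refine (eq_adj hL (mul_inv_cancel g) fun y => ?_).symm
  rw [← hγ]
  exact congrArg L.emb (TensorMap.rinner_adjoint β γ (hL.r_pairing hβ hγ) (hβ' x) y)

/-- `(t⋆ s⋆) (z r) = t⋆ (⟨s, z⟩ᵣ r) = ⟨t, ⟨s, z⟩ᵣ r⟩ᵣ = ⟨s t, z r⟩ᵣ`. -/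
lemma adjTotal_mul (s t : L.Total) : adjTotal hL (s * t) = adjTotal hL t * adjTotal hL s := by
  obtain ⟨g, x⟩ := s
  obtain ⟨h, y⟩ := t
  have e : (h⁻¹ * g⁻¹) * (g * h) = 1 := by group
  obtain ⟨β, hβ⟩ := L.exists_pairing e
  refine (eq_adj hL e (t := (L.mulMap h⁻¹ g⁻¹).toFun (adj hL y) (adj hL x))
    (x := (L.mulMap g h).toFun x y) fun w => ?_).symm
  rw [← hβ]
  refine congrArg L.emb ?_
  refine DFunLike.congr_fun (F := L.X (g * h) →+ B) (f := β.right _)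
    (g := (L.X (g * h)).rinnerHom' _) ((L.mulMap g h).addHom_ext fun z r =>
      emb_injective (L := L) ?_) w
  refine (hβ _ _).trans ?_
  change (⟨h⁻¹, adj hL y⟩ * ⟨g⁻¹, adj hL x⟩) * (⟨g, z⟩ * ⟨h, r⟩) =
    L.emb ((L.X (g * h)).rinner ((L.mulMap g h).toFun x y) ((L.mulMap g h).toFun z r))
  rw [hL.assoc, ← hL.assoc _ _ ⟨h, r⟩, adj_mul, emb_mul, adj_mul, (L.mulMap g h).rinner_map]

lemma emb_star (b : B) : L.emb (star b) = adjTotal hL (L.emb b) := by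
  refine eq_adj hL (mul_one 1) fun y => ?_
  obtain ⟨c, rfl⟩ := L.ι.toEquiv.surjective y
  refine (emb_mul _ _).trans (mk_inj.2 ?_)
  exact (L.ι.map_l _ _).symm.trans (congrArg L.ι (L.ι.rinner_map b c).symm)

/-- The total space of an associative choice, with the adjoints as involution. -/
noncomputable def gradedStarSemigroup : GradedStarSemigroup.{v, max u v} G where
  carrier := L.Total
  semigroup := { mul := (· * ·), mul_assoc := hL.assoc }
  starMul :=
    { star := adjTotal hL
      star_involutive := adjTotal_adjTotal hL
      star_mul := adjTotal_mul hL }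
  π := Total.deg
  π_mul _ _ := rfl
  π_star _ := rfl

/-- The fiber over `g` is `X g`. -/
def fibEquiv (g : G) : (gradedStarSemigroup hL).Fiber g ≃ L.X g where
  toFun s := s.2 ▸ s.1.val
  invFun x := ⟨⟨g, x⟩, rfl⟩
  left_inv := by rintro ⟨⟨g, x⟩, rfl⟩; rfl
  right_inv _ := rfl

noncomputable instance (g : G) : NormedAddCommGroup ((gradedStarSemigroup hL).Fiber g) :=
  (fibEquiv hL g).normedAddCommGroup

noncomputable instance (g : G) : NormedSpace ℂ ((gradedStarSemigroup hL).Fiber g) :=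
  (fibEquiv hL g).normedSpace ℂ

/-- The fiber over `g` is isometric to `X g`. -/
noncomputable def toFib (g : G) : L.X g ≃ₗᵢ[ℂ] (gradedStarSemigroup hL).Fiber g where
  toEquiv := (fibEquiv hL g).symm
  map_add' _ _ := rfl
  map_smul' _ _ := rfl
  norm_map' _ := rfl

lemma fmul_toFib {g h : G} (x : L.X g) (y : L.X h) :
    fmul (toFib hL g x) (toFib hL h y) = toFib hL (g * h) ((L.mulMap g h).toFun x y) := rfl

lemma fstar_toFib {g : G} (x : L.X g) :
    fstar (toFib hL g x) = toFib hL g⁻¹ (adj hL x) := rfl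

lemma adj_val_mul {g : G} (x y : L.X g) :
    (⟨g⁻¹ * g, (L.mulMap g⁻¹ g).toFun (adj hL x) y⟩ : L.Total) =
      ⟨1, L.ι ((L.X g).rinner x y)⟩ := adj_mul hL x y

/-- The Fell bundle of an associative choice. -/
noncomputable def fellBundle : FellBundle.{v, max u v} G where
  toGradedStarSemigroup := gradedStarSemigroup hL
  normedAddCommGroup := inferInstance
  normedSpace := inferInstance
  completeSpace g := 
    (completeSpace_congr (toFib hL g).isometry.isUniformEmbedding).1 inferInstance
  add_fmul {g h} s s' t := by
    obtain ⟨x, rfl⟩ := (toFib hL g).surjective s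
    obtain ⟨x', rfl⟩ := (toFib hL g).surjective s'
    obtain ⟨y, rfl⟩ := (toFib hL h).surjective t
    rw [← map_add, fmul_toFib, fmul_toFib, fmul_toFib, ← map_add, (L.mulMap g h).add_left]
  fmul_add {g h} s t t' := by
    obtain ⟨x, rfl⟩ := (toFib hL g).surjective s
    obtain ⟨y, rfl⟩ := (toFib hL h).surjective t
    obtain ⟨y', rfl⟩ := (toFib hL h).surjective t'
    rw [← map_add, fmul_toFib, fmul_toFib, fmul_toFib, ← map_add, (L.mulMap g h).add_right]
  smul_fmul {g h} z s t := by
    obtain ⟨x, rfl⟩ := (toFib hL g).surjective s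
    obtain ⟨y, rfl⟩ := (toFib hL h).surjective t
    rw [← map_smul, fmul_toFib, fmul_toFib, ← map_smul, ← l_smul_eq, (L.mulMap g h).map_l,
      l_smul_eq]
  fmul_smul {g h} z s t := by
    obtain ⟨x, rfl⟩ := (toFib hL g).surjective s
    obtain ⟨y, rfl⟩ := (toFib hL h).surjective t
    rw [← map_smul, fmul_toFib, fmul_toFib, ← map_smul, ← r_smul_eq, (L.mulMap g h).map_r,
      r_smul_eq]
  norm_fmul_le {g h} s t := by
    obtain ⟨x, rfl⟩ := (toFib hL g).surjective s
    obtain ⟨y, rfl⟩ := (toFib hL h).surjective t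
    rw [fmul_toFib, LinearIsometryEquiv.norm_map, LinearIsometryEquiv.norm_map,
      LinearIsometryEquiv.norm_map]
    exact (L.mulMap g h).norm_le x y
  fstar_add {g} s t := by
    obtain ⟨x, rfl⟩ := (toFib hL g).surjective s
    obtain ⟨y, rfl⟩ := (toFib hL g).surjective t
    rw [← map_add, fstar_toFib, fstar_toFib, fstar_toFib, ← map_add, adj_add]
  fstar_smul {g} z s := by
    obtain ⟨x, rfl⟩ := (toFib hL g).surjective s
    rw [← map_smul, fstar_toFib, fstar_toFib, ← map_smul, adj_smul]
  norm_fstar_fmul_self {g} s := by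
    obtain ⟨x, rfl⟩ := (toFib hL g).surjective s
    rw [fstar_toFib, fmul_toFib, LinearIsometryEquiv.norm_map, LinearIsometryEquiv.norm_map,
      norm_eq_of_mk_eq (adj_val_mul hL x x), norm_ι, (L.X g).norm_sq_eq_rinner]
  star_mul_self_nonneg := by
    rintro ⟨g, x⟩
    obtain ⟨b, hb⟩ := (L.X g).rinner_self_nonneg x
    refine ⟨toFib hL 1 (L.ι b), ?_⟩
    refine (adj_mul hL x x).trans ((congrArg L.emb ?_).trans (adj_mul hL (L.ι b) (L.ι b)).symm)
    exact hb.trans (L.ι.rinner_map b b).symm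

/-- The saturated Fell bundle of an associative choice. -/
noncomputable def saturatedFellBundle : SaturatedFellBundle.{u, v, max u v} G B where
  toFellBundle := fellBundle hL
  saturated g h := by
    refine dense_univ.mono fun s _ => ?_
    obtain ⟨p, rfl⟩ := (toFib hL (g * h)).surjective s
    obtain ⟨ι, _, x, y, rfl⟩ := (L.mulMap g h).exists_sum p
    rw [map_sum]
    exact Submodule.sum_mem _ fun i _ =>
      Submodule.subset_span ⟨(toFib hL g (x i), toFib hL h (y i)), rfl⟩
  unit := L.ι.toLinearIsometryEquiv.trans (toFib hL 1)
  unit_mul a b := by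
    refine Eq.trans ?_ (emb_mul a (L.ι b)).symm
    exact mk_inj.2 (L.ι.map_l a b)
  unit_star a := emb_star hL a

theorem hasPicard_saturatedFellBundle : (saturatedFellBundle hL).HasPicard ψ := by
  refine fun g => ⟨L.X g, L.mk_X g, ⟨?_⟩⟩
  refine ⟨(toFib hL g).toEquiv, map_add (toFib hL g), fun b x => Subtype.ext ?_,
    fun x b => Subtype.ext ?_, fun x y => ?_, fun x y => ?_⟩
  · exact (emb_mul b x).symm
  · exact (mul_emb x b).symm
  · refine SaturatedFellBundle.ext_unit (𝓑 := saturatedFellBundle hL) ?_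
    exact (SaturatedFellBundle.unit_linn _ _).trans (mul_adj hL x y)
  · refine SaturatedFellBundle.ext_unit (𝓑 := saturatedFellBundle hL) ?_
    exact (SaturatedFellBundle.unit_rinn _ _).trans (adj_mul hL x y)

end Choice

end FellExt

theorem mainTheorem2 {G : Type v} [Group G] {B : Type u} [CStarAlgebra B]
    (ψ : G →* FellExt.Pic B) :
    Nonempty (FellExt.Choice ψ) ∧
    (∀ L : FellExt.Choice ψ, ∃! ω : (Fin 3 → G) → FellExt.UZ B, L.IsDefect ω) ∧
    ∃ χ : FellExt.PicCohomology ψ 3,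
      (∀ (L : FellExt.Choice ψ) (ω : (Fin 3 → G) → FellExt.UZ B), L.IsDefect ω →
        ∃ hω : ω ∈ FellExt.cocycles ((FellExt.Pic.toAut B).comp ψ) 3,
          (QuotientGroup.mk ⟨ω, hω⟩ : FellExt.PicCohomology ψ 3) = χ) ∧
      ((FellExt.ExtOver ψ).Nonempty ↔ χ = 1) := by
  obtain ⟨L₀⟩ := FellExt.Choice.nonempty_choice ψ
  obtain ⟨ω₀, hω₀⟩ := L₀.exists_isDefect
  refine ⟨⟨L₀⟩, fun L => ?_, QuotientGroup.mk ⟨ω₀, hω₀.mem_cocycles⟩,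
    fun L ω hω => ⟨hω.mem_cocycles, hω.mk_eq_mk hω₀⟩, ?_, fun h => ?_⟩
  · obtain ⟨ω, hω⟩ := L.exists_isDefect
    exact ⟨ω, hω, fun ω' hω' => hω'.unique hω⟩
  · rintro ⟨_, 𝓑, -, h𝓑⟩
    obtain ⟨L, hL⟩ := h𝓑.exists_isDefect_one
    rw [hω₀.mk_eq_mk hL]
    rfl
  · have h1 := (QuotientGroup.eq_one_iff _).1 h
    obtain ⟨L, hL⟩ := hω₀.exists_isDefect_one (Subgroup.mem_subgroupOf.1 h1)
    exact ⟨_, _, rfl, FellExt.Choice.hasPicard_saturatedFellBundle hL⟩
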